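/- Let $M\ge 1$, let $Q=(q_{ij})\in\mathbb R^{M\times M}$ be an invertible covariance matrix (symmetric positive semidefinite and invertible) and let $P_0$ be a covariance matrix. Consider $M$ sources with joint state $x_t\in\mathbb R^M$, $x_{t+1}=x_t+w_t$ ($t\ge 0$), where $w_0,w_1,\dots$ are i.i.d. $\mathcal N(0,Q)$ and independent of $x_0\sim\mathcal N(\hat x_0,P_0)$, with $\hat x_0\in\mathbb R^M$ known. At each time $t\ge 0$ a monitor schedules exactly one sensor $\pi(t)\in\{1,\dots,M\}$ and receives $y_t=x_t^{\pi(t)}$. A policy is oblivious if $\pi(t)$ is a measurable function of the earlier decisions $\pi(0),\dots,\pi(t-1)$, the earlier samples $y_0,\dots,y_{t-1}$, and possibly a random seed independent of $x_0,w_0,w_1,\dots$; the estimate $\hat x_t$ is a measurable function of $\pi(0),y_0,\dots,\pi(t),y_t$. The monitoring error of a policy is $$\inf_{(\hat x_t)}\ \limsup_{T\to\infty}\frac1T\,\mathbb E\Big[\sum_{t=1}^T\|x_t-\hat x_t\|_2^2\Big],$$ and $P_{OPT}$ is its infimum over all oblivious policies. Write $\tilde q_{ii}=q_{ii}-\mathbf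 q_i^{T}Q_{-i}^{-1}\mathbf q_i$, where $Q_{-i}$ is $Q$ without row and column $i$, and $\mathbf q_i$ is the $i$-th column of $Q$ without its $i$-th entry. Then $$\frac12\Big(\sum_{i=1}^M\sqrt{\tilde q_{ii}}\Big)^2-\frac12\sum_{i=1}^M\tilde q_{ii}\ \le\ P_{OPT}\ \le\ \Big(\sum_{i=1}^M\sqrt{q_{ii}}\Big)^2-\sum_{i=1}^M q_{ii}.$$ The lower bound holds, for every oblivious policy and every estimator, even for the limit inferior of the averages. Moreover, let $c_t$ be the standard basis vector with index $\pi(t)$ and $P_{t+1}=P_t-\frac{P_tc_tc_t^TP_t}{c_t^TP_tc_t}+Q$, started at $P_0$ (the quotient being read as $0$ when $c_t^TP_tc_t=0$). Every oblivious policy that minimizes $\limsup_{T\to\infty}\frac1T\sum_{t=1}^T\mathbb E[\operatorname{tr}P_t]$ among all oblivious policies has a monitoring error between the same two bounds, and the infimum of this cost over all oblivious policies, minus $\operatorname{tr}Q$, lies between them as well. Consequently the optimal error scales as $M^2$: if $a\le\tilde q_{ii}$ and $q_{ii}\le b$ for all $i$, then $\frac a2M(M-1)\le P_{OPT}\le b\,M(M-1)$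 (the left bound being trivial for $a<0$). -/

import Mathlib

open MeasureTheory ProbabilityTheory Filter Matrix

/-! ### Weights -/

/-- `q̃ᵢᵢ = qᵢᵢ - qᵢᵀ (Q₋ᵢ)⁻¹ qᵢ`, where `Q₋ᵢ` is `Q` with row and column `i` removed and `qᵢ` is
the `i`-th column of `Q` without its `i`-th entry. -/
noncomputable def qTilde {M : ℕ} (Q : Matrix (Fin M) (Fin M) ℝ) (i : Fin M) : ℝ :=
  let qi : {j : Fin M // j ≠ i} → ℝ := fun j => Q j i
  let Qi : Matrix {j : Fin M // j ≠ i} {j : Fin M // j ≠ i} ℝ :=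
    Q.submatrix Subtype.val Subtype.val
  Q i i - qi ⬝ᵥ (Qi⁻¹ *ᵥ qi)

/-! ### The correlated sources -/

/-- The random inputs of the model: the initial state `x₀ ∼ N(x̂₀, P₀)`, the increments
`w₀, w₁, …`, which are i.i.d. `N(0, Q)`, and a seed `ξ` with values in some measurable space `S`,
the source of randomness of randomized scheduling policies. The three are independent. -/
structure IsSourceModel {M : ℕ} {Ω S : Type*} [MeasurableSpace Ω] [MeasurableSpace S]
    (μ : Measure Ω) (Q P₀ : Matrix (Fin M) (Fin M) ℝ) (xhat₀ : EuclideanSpace ℝ (Fin M))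
    (x₀ : Ω → EuclideanSpace ℝ (Fin M)) (w : ℕ → Ω → EuclideanSpace ℝ (Fin M))
    (ξ : Ω → S) : Prop where
  measurable_init : Measurable x₀
  measurable_incr : ∀ t, Measurable (w t)
  measurable_seed : Measurable ξ
  init_law : HasLaw x₀ (multivariateGaussian xhat₀ P₀) μ
  incr_law : ∀ t, HasLaw (w t) (multivariateGaussian 0 Q) μ
  incr_indep : iIndepFun w μ
  init_indep_incr : IndepFun x₀ (fun ω t => w t ω) μ
  seed_indep : IndepFun ξ (fun ω => (x₀ ω, fun t => w t ω)) μ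

/-- The state: `x_{t+1} = x_t + w_t`. -/
noncomputable def stateAt {M : ℕ} {Ω : Type*} (x₀ : Ω → EuclideanSpace ℝ (Fin M))
    (w : ℕ → Ω → EuclideanSpace ℝ (Fin M)) : ℕ → Ω → EuclideanSpace ℝ (Fin M)
  | 0, ω => x₀ ω
  | t + 1, ω => stateAt x₀ w t ω + w t ω

/-! ### Oblivious causal scheduling policies and estimators -/

/-- What the monitor has received before time `t`: the index of the scheduled sensor and the
received sample, for each of the times `0, …, t - 1`. -/
abbrev History (M t : ℕ) : Type := Fin t → Fin M × ℝ

/-- A (possibly randomized) oblivious policy: the sensor scheduled at time `t` is a measurable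
function of the seed, the previous scheduling decisions and the previously received samples. -/
structure ObliviousPolicy (M : ℕ) (S : Type*) [MeasurableSpace S] where
  decide : (t : ℕ) → S × History M t → Fin M
  measurable_decide : ∀ t, Measurable (decide t)

/-- The history generated by a policy along the state trajectory `x` for the seed `s`: at time `t`
the sensor `j` chosen by the policy is scheduled and the sample `y_t`, the `j`-th coordinate of the
state at time `t`, is received. -/
noncomputable def ObliviousPolicy.history {M : ℕ} {S : Type*} [MeasurableSpace S]
    (π : ObliviousPolicy M S) (s : S) (x : ℕ → EuclideanSpace ℝ (Fin M)) :
    (t : ℕ) → History M t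
  | 0 => Fin.elim0
  | t + 1 =>
    Fin.snoc (α := fun _ => Fin M × ℝ) (π.history s x t)
      (π.decide t (s, π.history s x t), x t (π.decide t (s, π.history s x t)))

/-- The index `π(t)` of the sensor scheduled at time `t`. -/
noncomputable def ObliviousPolicy.sensor {M : ℕ} {S : Type*} [MeasurableSpace S]
    (π : ObliviousPolicy M S) (s : S) (x : ℕ → EuclideanSpace ℝ (Fin M)) (t : ℕ) : Fin M :=
  π.decide t (s, π.history s x t)

/-- An estimation policy: the estimate at time `t` is a measurable function of everything received
up to and including time `t`. -/
structure EstimationPolicy (M : ℕ) where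
  estimate : (t : ℕ) → History M (t + 1) → EuclideanSpace ℝ (Fin M)
  measurable_estimate : ∀ t, Measurable (estimate t)

/-! ### The monitoring error -/

/-- `(1/T) 𝔼[∑_{t=1}^T ‖x_t - x̂_t‖²]` for a given scheduling and estimation policy. -/
noncomputable def averageError {M : ℕ} {Ω S : Type*} [MeasurableSpace Ω] [MeasurableSpace S]
    (μ : Measure Ω) (x₀ : Ω → EuclideanSpace ℝ (Fin M)) (w : ℕ → Ω → EuclideanSpace ℝ (Fin M))
    (ξ : Ω → S) (π : ObliviousPolicy M S) (η : EstimationPolicy M) (T : ℕ) : ENNReal :=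
  (T : ENNReal)⁻¹ * ∫⁻ ω, ∑ t ∈ Finset.Icc 1 T,
    ‖stateAt x₀ w t ω -
      η.estimate t (π.history (ξ ω) (fun k => stateAt x₀ w k ω) (t + 1))‖ₑ ^ 2 ∂μ

/-- The long-run average monitoring error of a scheduling policy, under optimal estimation. -/
noncomputable def monitoringError {M : ℕ} {Ω S : Type*} [MeasurableSpace Ω] [MeasurableSpace S]
    (μ : Measure Ω) (x₀ : Ω → EuclideanSpace ℝ (Fin M)) (w : ℕ → Ω → EuclideanSpace ℝ (Fin M))
    (ξ : Ω → S) (π : ObliviousPolicy M S) : ENNReal :=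
  ⨅ η : EstimationPolicy M, limsup (averageError μ x₀ w ξ π η) atTop

/-- The optimal long-run average error over all oblivious scheduling policies (and all
estimators). -/
noncomputable def optimalError {M : ℕ} {Ω S : Type*} [MeasurableSpace Ω] [MeasurableSpace S]
    (μ : Measure Ω) (x₀ : Ω → EuclideanSpace ℝ (Fin M)) (w : ℕ → Ω → EuclideanSpace ℝ (Fin M))
    (ξ : Ω → S) : ENNReal :=
  ⨅ π : ObliviousPolicy M S, monitoringError μ x₀ w ξ π

/-! ### The scheduling problem for the Kalman covariance recursion -/

/-- `P_{t+1} = P_t - (P_t c_t c_tᵀ P_t) / (c_tᵀ P_t c_t) + Q`, with `c_t` the standard basis vector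
of the sensor `c t`. If the denominator is `0` then so is the numerator (`P_t` being positive
semidefinite), and the quotient is `0`. -/
noncomputable def kalmanCov {M : ℕ} (Q P₀ : Matrix (Fin M) (Fin M) ℝ) (c : ℕ → Fin M) :
    ℕ → Matrix (Fin M) (Fin M) ℝ
  | 0 => P₀
  | t + 1 =>
    let P := kalmanCov Q P₀ c t
    let e : Fin M → ℝ := Pi.single (c t) 1
    P - (e ⬝ᵥ (P *ᵥ e))⁻¹ • (P * vecMulVec e e * P) + Q

/-- The objective `limsup_T (1/T) ∑_{t=1}^T 𝔼[tr P_t]` along the schedule produced by a policy. -/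
noncomputable def kalmanCost {M : ℕ} {Ω S : Type*} [MeasurableSpace Ω] [MeasurableSpace S]
    (μ : Measure Ω) (Q P₀ : Matrix (Fin M) (Fin M) ℝ)
    (x₀ : Ω → EuclideanSpace ℝ (Fin M)) (w : ℕ → Ω → EuclideanSpace ℝ (Fin M))
    (ξ : Ω → S) (π : ObliviousPolicy M S) : ENNReal :=
  limsup (fun T : ℕ => (T : ENNReal)⁻¹ * ∑ t ∈ Finset.Icc 1 T, ∫⁻ ω, ENNReal.ofReal
    (kalmanCov Q P₀ (π.sensor (ξ ω) (fun k => stateAt x₀ w k ω)) t).trace ∂μ) atTop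

/-- `π` minimizes the Kalman cost over all oblivious policies. -/
def IsKalmanOptimal {M : ℕ} {Ω S : Type*} [MeasurableSpace Ω] [MeasurableSpace S]
    (μ : Measure Ω) (Q P₀ : Matrix (Fin M) (Fin M) ℝ)
    (x₀ : Ω → EuclideanSpace ℝ (Fin M)) (w : ℕ → Ω → EuclideanSpace ℝ (Fin M))
    (ξ : Ω → S) (π : ObliviousPolicy M S) : Prop :=
  ∀ π' : ObliviousPolicy M S, kalmanCost μ Q P₀ x₀ w ξ π ≤ kalmanCost μ Q P₀ x₀ w ξ π'

/-! The problem reduces to estimates for deterministic schedules. Under a fixed schedule, a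
noiseless sample replaces the Gaussian error by its regression residual, so by induction the
prediction error is a centered Gaussian vector with the Kalman covariance, independent of the seed
and the earlier data (`IsSourceModel.kalman_prediction`). An oblivious policy decides from such data
only. Hence the event that it follows a given finite decision pattern is independent of the
posterior error under that pattern, and summing over patterns gives a bias-variance identity: the
error of any estimator is the expected trace of the posterior covariance plus the mean squared
distance to the Kalman estimate (`IsSourceModel.lintegral_error_eq`).

Lower bound, schedule by schedule: `q̃ᵢᵢ` is the least value of the form of `Q` on vectors with
`i`-th entry 1, and observing another coordinate moves the test vector without changing its `i`-th
entry. The posterior variance of source `i` is therefore at least `q̃ᵢᵢ` times the age of its last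
sample (`qTilde_mul_sampleAge_le`). A quadratic potential in the ages then bounds the time average
of their weighted sum, because only one sensor is reset per step (`sum_age_lower_bound`).

Upper bound: drawing sensor `j` with probability proportional to `√q_jj` makes a weighted sum of
diagonal variance bounds drift down by the current total bound, up to the claimed constant. Some
deterministic choice does at least as well, and the drift telescopes (`exists_greedy_step`,
`exists_schedule_trace_le`).

The Kalman cost sums prediction covariances, which are posterior covariances one step earlier plus
`Q`. The shift vanishes in the average, and what remains is `tr Q`. -/

/-! ### The Kalman update -/

/-- The covariance after a noiseless observation of the coordinate `j`. -/
noncomputable def postCov {M : ℕ} (P : Matrix (Fin M) (Fin M) ℝ) (j : Fin M) :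
    Matrix (Fin M) (Fin M) ℝ :=
  Matrix.of fun i k => P i k - (P j j)⁻¹ * (P i j * P j k)

lemma kalmanCov_succ {M : ℕ} (Q P₀ : Matrix (Fin M) (Fin M) ℝ) (c : ℕ → Fin M) (t : ℕ) :
    kalmanCov Q P₀ c (t + 1) = postCov (kalmanCov Q P₀ c t) (c t) + Q := by
  ext i k
  have h : (kalmanCov Q P₀ c t * vecMulVec (Pi.single (c t) 1) (Pi.single (c t) 1) *
      kalmanCov Q P₀ c t : Matrix (Fin M) (Fin M) ℝ) i k = kalmanCov Q P₀ c t i (c t) * kalmanCov Q P₀ c t (c t) k := by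
    rw [mul_vecMulVec, vecMulVec_mul]
    simp [vecMulVec_apply]
  simp only [kalmanCov, Matrix.add_apply, Matrix.sub_apply, Matrix.smul_apply, h, postCov,
    Matrix.of_apply, smul_eq_mul]
  simp

/-- This settles the degenerate update, where the observed coordinate already has variance zero and
the gain is read as zero. -/
lemma Matrix.PosSemidef.apply_eq_zero_of_diag_eq_zero {M : ℕ} {P : Matrix (Fin M) (Fin M) ℝ}
    (hP : P.PosSemidef) {j : Fin M} (hj : P j j = 0) (i : Fin M) : P i j = 0 := by
  have h := (hP.dotProduct_mulVec_zero_iff (Pi.single j 1)).1 (by simpa using hj)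
  simpa using congrFun h i

lemma Matrix.PosSemidef.apply_comm {M : ℕ} {P : Matrix (Fin M) (Fin M) ℝ}
    (hP : P.PosSemidef) (i j : Fin M) : P i j = P j i := by
  simpa using hP.isHermitian.apply j i

/-- The quadratic form of the updated covariance is obtained by moving along the observed
direction. -/
lemma dotProduct_postCov_mulVec {M : ℕ} {P : Matrix (Fin M) (Fin M) ℝ} (hP : P.PosSemidef)
    (j : Fin M) (v : Fin M → ℝ) :
    v ⬝ᵥ (postCov P j *ᵥ v) =
      (v - ((P j j)⁻¹ * (P *ᵥ v) j) • Pi.single j 1) ⬝ᵥ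
        (P *ᵥ (v - ((P j j)⁻¹ * (P *ᵥ v) j) • Pi.single j 1)) := by
  have hcol : ∀ i, (P *ᵥ Pi.single j 1) i = P i j := by intro i; simp
  have hv : v ⬝ᵥ (P *ᵥ Pi.single j 1) = (P *ᵥ v) j := by
    simp only [dotProduct, hcol]
    exact Finset.sum_congr rfl fun i _ => by rw [hP.apply_comm i j, mul_comm]
  have h1 : v ⬝ᵥ (postCov P j *ᵥ v) = v ⬝ᵥ (P *ᵥ v) - (P j j)⁻¹ * ((P *ᵥ v) j) ^ 2 := by
    have : postCov P j = P - (P j j)⁻¹ • vecMulVec (P *ᵥ Pi.single j 1) (P j) := by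
      ext i k; simp [postCov, vecMulVec_apply]
    rw [this, sub_mulVec, dotProduct_sub, smul_mulVec, dotProduct_smul, vecMulVec_mulVec]
    simp only [smul_eq_mul, dotProduct_smul, hv, MulOpposite.smul_eq_mul_unop, MulOpposite.unop_op]
    rw [show P j ⬝ᵥ v = (P *ᵥ v) j from rfl]; ring
  rw [h1]
  generalize hs : (P j j)⁻¹ * (P *ᵥ v) j = s
  have h2 : Pi.single j 1 ⬝ᵥ (P *ᵥ v) = (P *ᵥ v) j := by simp
  have h3 : (Pi.single j 1 : Fin M → ℝ) ⬝ᵥ (P *ᵥ Pi.single j 1) = P j j := by simp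
  simp only [mulVec_sub, mulVec_smul, dotProduct_sub, sub_dotProduct, smul_dotProduct,
    dotProduct_smul, smul_eq_mul, hv, h2, h3]
  -- With `0⁻¹ = 0` the shift vanishes in the degenerate case, and both sides are the form of `P` at
  -- `v`.
  by_cases h0 : P j j = 0
  · simp [h0] at hs
    simp [← hs, h0]
  · have : (P *ᵥ v) j = P j j * s := by rw [← hs]; field_simp
    rw [this]; field_simp; ring

lemma posSemidef_postCov {M : ℕ} {P : Matrix (Fin M) (Fin M) ℝ} (hP : P.PosSemidef) (j : Fin M) :
    (postCov P j).PosSemidef := by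
  refine PosSemidef.of_dotProduct_mulVec_nonneg ?_ fun v => ?_
  · ext i k
    simp only [conjTranspose_apply, postCov, of_apply, star_trivial]
    rw [hP.apply_comm k i, hP.apply_comm k j, hP.apply_comm i j]; ring
  · rw [star_trivial, dotProduct_postCov_mulVec hP]
    exact hP.dotProduct_mulVec_nonneg (v - ((P j j)⁻¹ * (P *ᵥ v) j) • Pi.single j 1)

lemma posSemidef_kalmanCov {M : ℕ} {Q P₀ : Matrix (Fin M) (Fin M) ℝ} (hQ : Q.PosSemidef)
    (hP₀ : P₀.PosSemidef) (c : ℕ → Fin M) (t : ℕ) : (kalmanCov Q P₀ c t).PosSemidef := by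
  induction t with
  | zero => exact hP₀
  | succ t ih => rw [kalmanCov_succ]; exact (posSemidef_postCov ih _).add hQ

lemma postCov_diag_self {M : ℕ} (P : Matrix (Fin M) (Fin M) ℝ) (j : Fin M) :
    postCov P j j j = 0 := by
  by_cases h : P j j = 0
  · simp [postCov, h]
  · simp only [postCov, of_apply]; field_simp; ring

lemma postCov_diag_le {M : ℕ} {P : Matrix (Fin M) (Fin M) ℝ} (hP : P.PosSemidef) (i j : Fin M) :
    postCov P j i i ≤ P i i := by
  simp only [postCov, of_apply, hP.apply_comm j i, sub_le_self_iff]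
  have := hP.diag_nonneg (i := j)
  have := mul_self_nonneg (P i j)
  positivity

/-- Causality of the recursion; it allows a random schedule to be replaced by a deterministic one on
the event that they agree so far. -/
lemma kalmanCov_congr {M : ℕ} (Q P₀ : Matrix (Fin M) (Fin M) ℝ) {c d : ℕ → Fin M} {t : ℕ}
    (h : ∀ k < t, c k = d k) : kalmanCov Q P₀ c t = kalmanCov Q P₀ d t := by
  induction t with
  | zero => rfl
  | succ t ih =>
    rw [kalmanCov_succ, kalmanCov_succ, ih fun k hk => h k (by omega), h t (by omega)]

/-! ### The conditional variances `q̃` -/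

/-- The vector `r` with `r i = 1` and `Q r = q̃ᵢᵢ eᵢ`. -/
lemma exists_mulVec_eq_qTilde {M : ℕ} {Q : Matrix (Fin M) (Fin M) ℝ} (hQ : Q.PosDef) (i : Fin M) :
    ∃ r : Fin M → ℝ, r i = 1 ∧ Q *ᵥ r = qTilde Q i • Pi.single i 1 := by
  set b : {j : Fin M // j ≠ i} → ℝ := fun j => Q j i with hb
  set A : Matrix {j : Fin M // j ≠ i} {j : Fin M // j ≠ i} ℝ :=
    Q.submatrix Subtype.val Subtype.val with hA
  have hApos : A.PosDef := hQ.submatrix Subtype.val_injective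
  obtain ⟨z, hz⟩ : ∃ z, z = A⁻¹ *ᵥ b := ⟨_, rfl⟩
  have hAz : A *ᵥ z = b := by
    rw [hz, mulVec_mulVec, mul_nonsing_inv _ ((isUnit_iff_isUnit_det _).1 hApos.isUnit),
      one_mulVec]
  have hq : qTilde Q i = Q i i - b ⬝ᵥ z := by rw [hz]; rfl
  -- The coefficients of the residual in the regression of coordinate `i` on the others.
  refine ⟨fun j => if h : j = i then 1 else -z ⟨j, h⟩, by simp, ?_⟩
  have key : ∀ k, (Q *ᵥ fun j => if h : j = i then 1 else -z ⟨j, h⟩) k =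
      Q k i - ∑ j : {j : Fin M // j ≠ i}, Q k j * z j := by
    intro k
    change ∑ j, Q k j * (if h : j = i then 1 else -z ⟨j, h⟩) = _
    rw [Fintype.sum_eq_add_sum_subtype_ne _ i]
    simp only [↓reduceDIte, mul_one, sub_eq_add_neg, ← Finset.sum_neg_distrib]
    congr 1
    refine Finset.sum_congr rfl fun j _ => ?_
    rw [dif_neg j.2, mul_neg]
  ext k
  rw [key]
  by_cases hk : k = i
  · subst hk
    rw [hq, Pi.smul_apply, Pi.single_eq_same, smul_eq_mul, mul_one]
    congr 1
    exact Finset.sum_congr rfl fun j _ => by rw [hQ.posSemidef.apply_comm]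
  · have h : ∑ j : {j : Fin M // j ≠ i}, Q k j * z j = Q k i := congrFun hAz ⟨k, hk⟩
    rw [h, Pi.smul_apply, Pi.single_eq_of_ne hk, smul_zero, sub_self]

/-- Split `v = v i • r + n` with `n i = 0`. Since `Q r` is a multiple of `eᵢ`, the cross terms
vanish, and the form at `n` is nonnegative. -/
lemma qTilde_mul_sq_le {M : ℕ} {Q : Matrix (Fin M) (Fin M) ℝ} (hQ : Q.PosDef) (i : Fin M)
    (v : Fin M → ℝ) : qTilde Q i * v i ^ 2 ≤ v ⬝ᵥ (Q *ᵥ v) := by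
  obtain ⟨r, hri, hr⟩ := exists_mulVec_eq_qTilde hQ i
  obtain ⟨n, hn⟩ : ∃ n, v = v i • r + n := ⟨v - v i • r, by simp⟩
  have hni : n i = 0 := by
    have := congrFun hn i
    simpa [hri] using this
  have hnr : n ⬝ᵥ (Q *ᵥ r) = 0 := by rw [hr]; simp [hni]
  have hrn : r ⬝ᵥ (Q *ᵥ n) = 0 := by
    rw [dotProduct_mulVec, ← mulVec_transpose, dotProduct_comm,
      show Qᵀ = Q by simpa using hQ.isHermitian.eq, hnr]
  have hrr : r ⬝ᵥ (Q *ᵥ r) = qTilde Q i := by rw [hr]; simp [hri]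
  have hnn : 0 ≤ n ⬝ᵥ (Q *ᵥ n) := by simpa using hQ.posSemidef.dotProduct_mulVec_nonneg n
  have : v ⬝ᵥ (Q *ᵥ v) = qTilde Q i * v i ^ 2 + n ⬝ᵥ (Q *ᵥ n) := by
    conv_lhs => rw [hn]
    simp only [mulVec_add, mulVec_smul, dotProduct_add, add_dotProduct, smul_dotProduct,
      dotProduct_smul, smul_eq_mul, hnr, hrn, hrr]
    ring
  linarith

lemma qTilde_nonneg {M : ℕ} {Q : Matrix (Fin M) (Fin M) ℝ} (hQ : Q.PosDef) (i : Fin M) :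
    0 ≤ qTilde Q i := by
  obtain ⟨r, hri, hr⟩ := exists_mulVec_eq_qTilde hQ i
  have h : 0 ≤ r ⬝ᵥ (Q *ᵥ r) := by simpa using hQ.posSemidef.dotProduct_mulVec_nonneg r
  rwa [hr, dotProduct_smul, dotProduct_single, hri, mul_one, smul_eq_mul, mul_one] at h

/-! ### Lower bound for every schedule -/

/-- The age of the last sample of sensor `i` under the schedule `c` (counted from time `0`). -/
noncomputable def sampleAge {M : ℕ} (c : ℕ → Fin M) (i : Fin M) : ℕ → ℝ
  | 0 => 0
  | t + 1 => if c (t + 1) = i then 0 else sampleAge c i t + 1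

/-- Each step without a sample of `i` adds at least `q̃ᵢᵢ (v i)²` through `Q`. The statement is for
all `v`, since the induction hypothesis is needed at the shifted test vector. -/
lemma qTilde_mul_sampleAge_le {M : ℕ} {Q P₀ : Matrix (Fin M) (Fin M) ℝ} (hQ : Q.PosDef)
    (hP₀ : P₀.PosSemidef) (c : ℕ → Fin M) (i : Fin M) (t : ℕ) (v : Fin M → ℝ) :
    qTilde Q i * sampleAge c i t * v i ^ 2 ≤
      v ⬝ᵥ (postCov (kalmanCov Q P₀ c t) (c t) *ᵥ v) := by
  have hpos : ∀ t, (postCov (kalmanCov Q P₀ c t) (c t)).PosSemidef := fun t =>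
    posSemidef_postCov (posSemidef_kalmanCov hQ.posSemidef hP₀ c t) _
  induction t generalizing v with
  | zero => simpa [sampleAge] using (hpos 0).dotProduct_mulVec_nonneg v
  | succ t ih =>
    by_cases hc : c (t + 1) = i
    · simpa [sampleAge, hc] using (hpos (t + 1)).dotProduct_mulVec_nonneg v
    · rw [dotProduct_postCov_mulVec (posSemidef_kalmanCov hQ.posSemidef hP₀ c _)]
      -- The size of the shift is irrelevant: it is along a coordinate other than `i`, so `v i` is
      -- kept.
      generalize ((kalmanCov Q P₀ c (t + 1) (c (t + 1)) (c (t + 1)))⁻¹ *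
        (kalmanCov Q P₀ c (t + 1) *ᵥ v) (c (t + 1))) = s
      set u := v - s • Pi.single (c (t + 1)) 1
      have hu : u i = v i := by simp [u, Pi.single_eq_of_ne (Ne.symm hc)]
      have h1 := ih u
      have h2 := qTilde_mul_sq_le hQ i u
      rw [kalmanCov_succ, add_mulVec, dotProduct_add]
      rw [hu] at h1 h2
      simp only [sampleAge, hc, if_false]
      linarith

lemma sum_qTilde_mul_sampleAge_le_trace {M : ℕ} {Q P₀ : Matrix (Fin M) (Fin M) ℝ} (hQ : Q.PosDef)
    (hP₀ : P₀.PosSemidef) (c : ℕ → Fin M) (t : ℕ) :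
    ∑ i, qTilde Q i * sampleAge c i t ≤ (postCov (kalmanCov Q P₀ c t) (c t)).trace := by
  refine Finset.sum_le_sum fun i _ => ?_
  simpa using qTilde_mul_sampleAge_le hQ hP₀ c i t (Pi.single i 1)

/-- Potential argument for the ages of a single sensor. -/
lemma sq_age_potential_le {q S a : ℝ} (hq : 0 ≤ q) (p : Prop) [Decidable p] :
    1 / 2 * (√q * ((if p then 0 else a + 1) + 1) - S) ^ 2 - 1 / 2 * (√q * (a + 1) - S) ^ 2 ≤
      q * (if p then 0 else a + 1) + S ^ 2 / 2 * (if p then 1 else 0) + q / 2 - S * √q := by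
  obtain ⟨r, hr, rfl⟩ : ∃ r, √q = r ∧ q = r ^ 2 := ⟨√q, rfl, (Real.sq_sqrt hq).symm⟩
  rw [hr]
  split_ifs
  -- On a reset the old potential is simply dropped; without a reset the bound is an identity.
  · nlinarith [sq_nonneg (r * (a + 1) - S)]
  · exact le_of_eq (by ring)

/-- Summed over the sensors, the one-step bounds contribute `S²/2` for the single reset and `-S²`
from the linear terms, which leaves the drift constant `(S² - ∑ q)/2`. The subtracted constant is
the initial potential. -/
lemma sum_age_lower_bound {M : ℕ} (q : Fin M → ℝ) (hq : ∀ i, 0 ≤ q i) (c : ℕ → Fin M) (T : ℕ) :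
    T * (1 / 2 * (∑ i, √(q i)) ^ 2 - 1 / 2 * ∑ i, q i) -
        ∑ i, 1 / 2 * (√(q i) - ∑ j, √(q j)) ^ 2 ≤
      ∑ t ∈ Finset.Icc 1 T, ∑ i, q i * sampleAge c i t := by
  set S := ∑ j, √(q j) with hS
  -- The terminal potential is kept for the induction and discarded afterwards by nonnegativity.
  suffices h : T * (1 / 2 * S ^ 2 - 1 / 2 * ∑ i, q i) +
      ∑ i, 1 / 2 * (√(q i) * (sampleAge c i T + 1) - S) ^ 2 -
        ∑ i, 1 / 2 * (√(q i) - S) ^ 2 ≤ ∑ t ∈ Finset.Icc 1 T, ∑ i, q i * sampleAge c i t by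
    have : 0 ≤ ∑ i, 1 / 2 * (√(q i) * (sampleAge c i T + 1) - S) ^ 2 :=
      Finset.sum_nonneg fun i _ => by positivity
    linarith
  induction T with
  | zero => simp [sampleAge]
  | succ T ih =>
    rw [Finset.sum_Icc_succ_top (by omega)]
    have hstep : ∑ i, (1 / 2 * (√(q i) * (sampleAge c i (T + 1) + 1) - S) ^ 2 -
        1 / 2 * (√(q i) * (sampleAge c i T + 1) - S) ^ 2) ≤
        ∑ i, (q i * sampleAge c i (T + 1) + S ^ 2 / 2 * (if c (T + 1) = i then 1 else 0) +
          q i / 2 - S * √(q i)) :=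
      Finset.sum_le_sum fun i _ => sq_age_potential_le (hq i) _
    have h1 : ∑ i, S ^ 2 / 2 * (if c (T + 1) = i then (1 : ℝ) else 0) = S ^ 2 / 2 := by simp
    have h2 : ∑ i, S * √(q i) = S ^ 2 := by rw [← Finset.mul_sum, ← hS, sq]
    have h3 : ∑ i, q i / 2 = 1 / 2 * ∑ i, q i := by rw [← Finset.sum_div]; ring
    rw [Finset.sum_sub_distrib, Finset.sum_sub_distrib, Finset.sum_add_distrib,
      Finset.sum_add_distrib, h1, h2, h3] at hstep
    push_cast
    linarith

/-! ### A deterministic schedule for the upper bound -/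

/-- The diagonal upper bounds for the covariance: reset at the scheduled sensor, growth by `q` at
the others. -/
noncomputable def varBoundNext {M : ℕ} (q : Fin M → ℝ) (a : Fin M → ℝ) (j : Fin M) : Fin M → ℝ :=
  fun i => if i = j then 0 else a i + q i

/-- One step of the greedy schedule. -/
lemma exists_greedy_step {M : ℕ} (hM : 0 < M) {q : Fin M → ℝ} (hq : ∀ i, 0 < q i)
    (a : Fin M → ℝ) :
    ∃ j, ∑ i, (∑ k, √(q k)) / √(q i) * varBoundNext q a j i + ∑ i, a i ≤
      ∑ i, (∑ k, √(q k)) / √(q i) * a i + ((∑ k, √(q k)) ^ 2 - ∑ i, q i) := by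
  have : Nonempty (Fin M) := ⟨⟨0, hM⟩⟩
  set S := ∑ k, √(q k) with hS
  have hr : ∀ i, 0 < √(q i) := fun i => Real.sqrt_pos.2 (hq i)
  have hSpos : 0 < S := Finset.sum_pos (fun i _ => hr i) Finset.univ_nonempty
  -- Averaging: if every `j` failed, adding the failures with weights `√(q j)` would give a strict
  -- inequality, but the weighted total of the left sides equals `S` times the right side.
  by_contra! hcon
  have hsum := Finset.sum_lt_sum_of_nonempty (s := (Finset.univ : Finset (Fin M)))
    Finset.univ_nonempty fun j _ => mul_lt_mul_of_pos_left (hcon j) (hr j)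
  rw [← Finset.sum_mul, ← hS] at hsum
  have hv : ∀ j, ∑ i, S / √(q i) * varBoundNext q a j i =
      ∑ i, S / √(q i) * (a i + q i) - S / √(q j) * (a j + q j) := by
    intro j
    rw [eq_sub_iff_add_eq, ← Finset.sum_erase_add _ _ (Finset.mem_univ j),
      ← Finset.sum_erase_add (a := j) Finset.univ (fun i => S / √(q i) * (a i + q i))
        (Finset.mem_univ j)]
    simp only [varBoundNext, if_true, mul_zero, add_zero]
    congr 1
    exact Finset.sum_congr rfl fun i hi => by rw [if_neg (Finset.ne_of_mem_erase hi)]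
  have hj : ∀ j, √(q j) * (∑ i, S / √(q i) * varBoundNext q a j i + ∑ i, a i) =
      √(q j) * (∑ i, S / √(q i) * (a i + q i) + ∑ i, a i) - S * (a j + q j) := by
    intro j
    rw [hv]
    have := (hr j).ne'
    field_simp
    ring
  simp only [hj, Finset.sum_sub_distrib, ← Finset.sum_mul, ← Finset.mul_sum, ← hS,
    Finset.sum_add_distrib, mul_add] at hsum
  have hSq : ∑ i, S / √(q i) * q i = S ^ 2 := by
    rw [sq, hS, Finset.mul_sum, ← hS]
    refine Finset.sum_congr rfl fun i _ => ?_
    have := (hr i).ne'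
    have h2 := Real.mul_self_sqrt (hq i).le
    field_simp
    nlinarith
  rw [hSq] at hsum
  nlinarith

/-- The diagonal bounds along the greedy schedule. -/
noncomputable def greedyBound {M : ℕ} (q : Fin M → ℝ) (next : (Fin M → ℝ) → Fin M)
    (a₀ : Fin M → ℝ) : ℕ → Fin M → ℝ
  | 0 => a₀
  | t + 1 => varBoundNext q (greedyBound q next a₀ t) (next (greedyBound q next a₀ t))

/-- An observation resets its own variance and never increases the others, so the greedy bounds
dominate the posterior diagonals whatever the correlations. The constant is the weighted bound at
time 1, where the telescoping starts. -/
lemma exists_schedule_trace_le {M : ℕ} (hM : 0 < M) {Q P₀ : Matrix (Fin M) (Fin M) ℝ}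
    (hQ : Q.PosDef) (hP₀ : P₀.PosSemidef) :
    ∃ (c : ℕ → Fin M) (C : ℝ), ∀ T : ℕ,
      ∑ t ∈ Finset.Icc 1 T, (postCov (kalmanCov Q P₀ c t) (c t)).trace ≤
        T * ((∑ i, √(Q i i)) ^ 2 - ∑ i, Q i i) + C := by
  have : Nonempty (Fin M) := ⟨⟨0, hM⟩⟩
  set q : Fin M → ℝ := fun i => Q i i with hqdef
  have hq : ∀ i, 0 < q i := fun i => hQ.diag_pos
  choose next hnext using exists_greedy_step hM hq
  set a := greedyBound q next (fun i => P₀ i i) with ha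
  -- The first sensor is arbitrary: `a 0` is the prior diagonal, which bounds the posterior one for
  -- any choice.
  set c : ℕ → Fin M := fun t => Nat.casesOn t ⟨0, hM⟩ fun s => next (a s) with hc
  have ha_nonneg : ∀ t i, 0 ≤ a t i := by
    intro t
    induction t with
    | zero => intro i; exact hP₀.diag_nonneg
    | succ t ih =>
      intro i
      change 0 ≤ if i = _ then (0 : ℝ) else a t i + q i
      split_ifs
      · exact le_rfl
      · exact add_nonneg (ih i) (hq i).le
  have hdiag : ∀ t i, postCov (kalmanCov Q P₀ c t) (c t) i i ≤ a t i := by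
    intro t
    induction t with
    | zero => intro i; exact postCov_diag_le hP₀ i _
    | succ t ih =>
      intro i
      change _ ≤ if i = c (t + 1) then (0 : ℝ) else a t i + q i
      split_ifs with hi
      · rw [hi, postCov_diag_self]
      · refine (postCov_diag_le (posSemidef_kalmanCov hQ.posSemidef hP₀ c _) i _).trans ?_
        rw [kalmanCov_succ]
        exact add_le_add (ih i) le_rfl
  set S := ∑ k, √(q k) with hS
  have hweight : ∀ t, 0 ≤ ∑ i, S / √(q i) * a t i := fun t =>
    Finset.sum_nonneg fun i _ => mul_nonneg (by positivity) (ha_nonneg t i)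
  have htel : ∀ T : ℕ, ∑ t ∈ Finset.Icc 1 T, ∑ i, a t i + ∑ i, S / √(q i) * a (T + 1) i ≤
      T * (S ^ 2 - ∑ i, q i) + ∑ i, S / √(q i) * a 1 i := by
    intro T
    induction T with
    | zero => simp
    | succ T ih =>
      rw [Finset.sum_Icc_succ_top (by omega)]
      have : ∑ i, S / √(q i) * a (T + 1 + 1) i + ∑ i, a (T + 1) i ≤
        ∑ i, S / √(q i) * a (T + 1) i + (S ^ 2 - ∑ i, q i) := hnext (a (T + 1))
      push_cast
      linarith
  refine ⟨c, ∑ i, S / √(q i) * a 1 i, fun T => ?_⟩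
  have h1 : ∑ t ∈ Finset.Icc 1 T, (postCov (kalmanCov Q P₀ c t) (c t)).trace ≤
      ∑ t ∈ Finset.Icc 1 T, ∑ i, a t i :=
    Finset.sum_le_sum fun t _ => Finset.sum_le_sum fun i _ => hdiag t i
  linarith [htel T, hweight (T + 1)]

/-! ### Independence -/

/-- The joint law is the product of the three marginals, which is then regrouped by associativity.
This is the tool for adjoining information piece by piece. -/
lemma ProbabilityTheory.IndepFun.indepFun_prodMk_of_indepFun_prodMk {Ω α β γ : Type*}
    [MeasurableSpace Ω] [MeasurableSpace α] [MeasurableSpace β] [MeasurableSpace γ]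
    {μ : Measure Ω} [IsProbabilityMeasure μ] {A : Ω → α} {B : Ω → β} {C : Ω → γ}
    (hA : Measurable A) (hB : Measurable B) (hC : Measurable C) (hAB : IndepFun A B μ)
    (hCAB : IndepFun C (fun ω => (A ω, B ω)) μ) : IndepFun A (fun ω => (B ω, C ω)) μ := by
  have := Measure.isProbabilityMeasure_map (μ := μ) hA.aemeasurable
  have := Measure.isProbabilityMeasure_map (μ := μ) hB.aemeasurable
  have := Measure.isProbabilityMeasure_map (μ := μ) hC.aemeasurable
  have hBC : IndepFun B C μ := (hCAB.comp measurable_id measurable_snd).symm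
  have h1 := (indepFun_iff_map_prod_eq_prod_map_map (by fun_prop) (by fun_prop)).1 hCAB.symm
  rw [(indepFun_iff_map_prod_eq_prod_map_map (by fun_prop) (by fun_prop)).1 hAB] at h1
  rw [indepFun_iff_map_prod_eq_prod_map_map (by fun_prop) (by fun_prop),
    (indepFun_iff_map_prod_eq_prod_map_map (by fun_prop) (by fun_prop)).1 hBC,
    ← Measure.prodAssoc_prod, ← h1, Measure.map_map (by fun_prop) (by fun_prop)]
  rfl

/-! ### Centered Gaussian vectors with given covariance matrix -/

/-- `e` is a centered Gaussian vector with covariance matrix `P`. -/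
structure IsCenteredGaussian {M : ℕ} {Ω : Type*} [MeasurableSpace Ω] (μ : Measure Ω)
    (e : Ω → EuclideanSpace ℝ (Fin M)) (P : Matrix (Fin M) (Fin M) ℝ) : Prop where
  gaussian : HasGaussianLaw e μ
  mean : ∀ i, ∫ ω, e ω i ∂μ = 0
  cov : ∀ i j, cov[fun ω => e ω i, fun ω => e ω j; μ] = P i j

namespace IsCenteredGaussian

variable {M : ℕ} {Ω : Type*} [MeasurableSpace Ω] {μ : Measure Ω} [IsProbabilityMeasure μ]
  {e w : Ω → EuclideanSpace ℝ (Fin M)} {P Q : Matrix (Fin M) (Fin M) ℝ}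

omit [IsProbabilityMeasure μ] in
lemma gaussian_eval (h : IsCenteredGaussian μ e P) (i : Fin M) :
    HasGaussianLaw (fun ω => e ω i) μ :=
  h.gaussian.map_fun (EuclideanSpace.proj i)

omit [IsProbabilityMeasure μ] in
lemma memLp_eval (h : IsCenteredGaussian μ e P) (i : Fin M) : MemLp (fun ω => e ω i) 2 μ :=
  (h.gaussian_eval i).memLp_two

lemma of_hasLaw {x : Ω → EuclideanSpace ℝ (Fin M)} {m : EuclideanSpace ℝ (Fin M)}
    (hP : P.PosSemidef) (hx : HasLaw x (multivariateGaussian m P) μ) :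
    IsCenteredGaussian μ (fun ω => x ω - m) P := by
  have hg : HasGaussianLaw x μ := hx.hasGaussianLaw
  have hi : ∀ i, HasGaussianLaw (fun ω => x ω i) μ := fun i =>
    hg.map_fun (EuclideanSpace.proj i)
  refine ⟨?_, fun i => ?_, fun i j => ?_⟩
  · have hc : HasLaw (fun ω => x ω - m) ((multivariateGaussian m P).map (· - m)) μ :=
      HasLaw.fun_comp (Y := fun z => z - m) ⟨by fun_prop, rfl⟩ hx
    exact hc.hasGaussianLaw
  · have h1 : ∫ ω, x ω i ∂μ = m i := by
      have h2 : ∫ ω, x ω ∂μ = m := by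
        have := hx.integral_eq
        rw [integral_id_multivariateGaussian] at this
        exact this
      rw [← h2]
      exact (EuclideanSpace.proj (𝕜 := ℝ) i).integral_comp_comm hg.integrable
    simp only [PiLp.sub_apply]
    rw [integral_sub (hi i).integrable (integrable_const _), h1]
    simp
  · simp only [PiLp.sub_apply]
    rw [covariance_fun_sub_fun_sub (hi i).memLp_two (memLp_const _) (hi j).memLp_two
      (memLp_const _), ← covariance_eval_multivariateGaussian (μ := m) hP i j,
      ← hx.covariance_fun_comp (by fun_prop) (by fun_prop)]
    simp

lemma add (h : IsCenteredGaussian μ e P) (hw : IsCenteredGaussian μ w Q) (hi : IndepFun e w μ) :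
    IsCenteredGaussian μ (fun ω => e ω + w ω) (P + Q) := by
  have h0 : ∀ i j, cov[fun ω => e ω i, fun ω => w ω j; μ] = 0 := fun i j =>
    (hi.comp (φ := fun z : EuclideanSpace ℝ (Fin M) => z i)
      (ψ := fun z : EuclideanSpace ℝ (Fin M) => z j) (by fun_prop) (by fun_prop)).covariance_eq_zero
      (h.memLp_eval i) (hw.memLp_eval j)
  refine ⟨(hi.hasGaussianLaw h.gaussian hw.gaussian).fun_add, fun i => ?_, fun i j => ?_⟩
  · simp only [PiLp.add_apply]
    rw [integral_add (h.gaussian_eval i).integrable (hw.gaussian_eval i).integrable, h.mean,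
      hw.mean, add_zero]
  · change cov[(fun ω => e ω i) + (fun ω => w ω i), (fun ω => e ω j) + (fun ω => w ω j); μ] = _
    have hs := (h.memLp_eval j).add (hw.memLp_eval j)
    rw [covariance_add_left (h.memLp_eval i) (hw.memLp_eval i) hs,
      covariance_add_right (h.memLp_eval i) (h.memLp_eval j) (hw.memLp_eval j),
      covariance_add_right (hw.memLp_eval i) (h.memLp_eval j) (hw.memLp_eval j),
      h.cov, hw.cov, h0, covariance_comm, h0]
    simp

end IsCenteredGaussian

/-- The Kalman gain for a noiseless observation of the coordinate `j`. -/
noncomputable def kalmanGain {M : ℕ} (P : Matrix (Fin M) (Fin M) ℝ) (j : Fin M) :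
    EuclideanSpace ℝ (Fin M) :=
  WithLp.toLp 2 fun i => (P j j)⁻¹ * P i j

namespace IsCenteredGaussian

variable {M : ℕ} {Ω : Type*} [MeasurableSpace Ω] {μ : Measure Ω} [IsProbabilityMeasure μ]
  {e w : Ω → EuclideanSpace ℝ (Fin M)} {P Q : Matrix (Fin M) (Fin M) ℝ}

/-- The gain is the regression coefficient on coordinate `j`, so the residual is uncorrelated with
that coordinate. -/
lemma cov_update (h : IsCenteredGaussian μ e P) (hP : P.PosSemidef) (j i : Fin M) :
    cov[fun ω => e ω i - e ω j * kalmanGain P j i, fun ω => e ω j; μ] = 0 := by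
  rw [covariance_fun_sub_left (h.memLp_eval i) ((h.memLp_eval j).mul_const _) (h.memLp_eval j),
    covariance_mul_const_left, h.cov, h.cov]
  by_cases h0 : P j j = 0
  · simp [h0, hP.apply_eq_zero_of_diag_eq_zero h0]
  · simp only [kalmanGain]; field_simp; ring

lemma update (h : IsCenteredGaussian μ e P) (hP : P.PosSemidef) (j : Fin M) :
    IsCenteredGaussian μ (fun ω => e ω - e ω j • kalmanGain P j) (postCov P j) := by
  refine ⟨?_, fun i => ?_, fun i k => ?_⟩
  · exact h.gaussian.map_fun (ContinuousLinearMap.id ℝ _ -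
      (EuclideanSpace.proj (𝕜 := ℝ) j).smulRight (kalmanGain P j))
  · simp only [PiLp.sub_apply, PiLp.smul_apply, smul_eq_mul]
    rw [integral_sub (h.gaussian_eval i).integrable
      ((h.gaussian_eval j).integrable.mul_const _), h.mean, integral_mul_const, h.mean]
    simp
  · simp only [PiLp.sub_apply, PiLp.smul_apply, smul_eq_mul]
    have hm : MemLp (fun ω => e ω i - e ω j * kalmanGain P j i) 2 μ :=
      (h.memLp_eval i).sub ((h.memLp_eval j).mul_const _)
    rw [covariance_fun_sub_right hm (h.memLp_eval k) ((h.memLp_eval j).mul_const _),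
      covariance_mul_const_right, h.cov_update hP, zero_mul, sub_zero,
      covariance_fun_sub_left (h.memLp_eval i) ((h.memLp_eval j).mul_const _) (h.memLp_eval k),
      covariance_mul_const_left, h.cov, h.cov]
    simp only [kalmanGain, postCov, of_apply]
    ring

/-- Residual and observed coordinate are a linear image of one Gaussian vector, so being
uncorrelated makes them independent. -/
lemma indepFun_update (h : IsCenteredGaussian μ e P) (hP : P.PosSemidef) (j : Fin M) :
    IndepFun (fun ω => e ω - e ω j • kalmanGain P j) (fun ω => e ω j) μ := by
  have hg : HasGaussianLaw (fun ω => (e ω - e ω j • kalmanGain P j, e ω j)) μ :=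
    h.gaussian.map_fun ((ContinuousLinearMap.id ℝ _ -
      (EuclideanSpace.proj (𝕜 := ℝ) j).smulRight (kalmanGain P j)).prod
        (EuclideanSpace.proj (𝕜 := ℝ) j))
  -- The pair is rewritten as two finite families, the second indexed by `Unit`, to fit the
  -- coordinatewise independence criterion.
  have hg' := hg.map_fun (((PiLp.continuousLinearEquiv 2 ℝ (fun _ : Fin M => ℝ)
    ).toContinuousLinearMap).prodMap (ContinuousLinearMap.pi
      (fun _ : Unit => ContinuousLinearMap.id ℝ ℝ)))
  have hi := HasGaussianLaw.indepFun_of_covariance_eval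
    (X := fun i ω => e ω i - e ω j * kalmanGain P j i) (Y := fun (_ : Unit) ω => e ω j)
    hg' (fun i _ => h.cov_update hP j i)
  exact hi.comp (φ := WithLp.toLp 2) (ψ := fun f : Unit → ℝ => f ()) (by fun_prop) (by fun_prop)

/-- The cross term vanishes because `e` is centered. -/
lemma lintegral_enorm_add_sq (h : IsCenteredGaussian μ e P) (hP : P.PosSemidef)
    (g : EuclideanSpace ℝ (Fin M)) :
    ∫⁻ ω, ‖e ω + g‖ₑ ^ 2 ∂μ = ENNReal.ofReal P.trace + ‖g‖ₑ ^ 2 := by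
  have hn : ∀ z : EuclideanSpace ℝ (Fin M), ‖z‖ₑ ^ 2 = ENNReal.ofReal (∑ i, z i ^ 2) := by
    intro z
    rw [← ofReal_norm, ← ENNReal.ofReal_pow (norm_nonneg _),
      EuclideanSpace.real_norm_sq_eq]
  have hint : ∀ i, Integrable (fun ω => (e ω i + g i) ^ 2) μ := fun i =>
    ((h.memLp_eval i).add (memLp_const (g i))).integrable_sq
  have hval : ∀ i, ∫ ω, (e ω i + g i) ^ 2 ∂μ = P i i + g i ^ 2 := by
    intro i
    have hsq : ∫ ω, e ω i ^ 2 ∂μ = P i i := by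
      rw [← h.cov i i, covariance_eq_sub (h.memLp_eval i) (h.memLp_eval i)]
      simp [h.mean i, sq]
    have : (fun ω => (e ω i + g i) ^ 2) = fun ω => e ω i ^ 2 + (e ω i * (2 * g i) + g i ^ 2) := by
      funext ω; ring
    have hi1 : Integrable (fun ω => e ω i * (2 * g i)) μ :=
      (h.gaussian_eval i).integrable.mul_const _
    have hi2 : Integrable (fun ω => e ω i * (2 * g i) + g i ^ 2) μ :=
      hi1.add (integrable_const _)
    rw [this, integral_add (h.memLp_eval i).integrable_sq hi2,
      integral_add hi1 (integrable_const _), hsq, integral_mul_const, h.mean]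
    simp
  simp only [hn, PiLp.add_apply]
  rw [← ofReal_integral_eq_lintegral_ofReal (integrable_finsetSum _ fun i _ => hint i)
    (ae_of_all _ fun ω => Finset.sum_nonneg fun i _ => sq_nonneg _),
    integral_finsetSum _ fun i _ => hint i,
    ← ENNReal.ofReal_add hP.trace_nonneg (Finset.sum_nonneg fun i _ => sq_nonneg _)]
  simp only [hval, Finset.sum_add_distrib]
  rfl

/-- Bias-variance decomposition given independent information `Z`. -/
lemma setLIntegral_enorm_add_sq {α : Type*} [MeasurableSpace α] {Z : Ω → α} {B : Set α}
    {g : α → EuclideanSpace ℝ (Fin M)} (h : IsCenteredGaussian μ e P) (hP : P.PosSemidef)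
    (he : Measurable e) (hZ : Measurable Z) (hi : IndepFun e Z μ) (hB : MeasurableSet B)
    (hg : Measurable g) :
    ∫⁻ ω in Z ⁻¹' B, ‖e ω + g (Z ω)‖ₑ ^ 2 ∂μ =
      ∫⁻ ω in Z ⁻¹' B, (ENNReal.ofReal P.trace + ‖g (Z ω)‖ₑ ^ 2) ∂μ := by
  have := Measure.isProbabilityMeasure_map (μ := μ) he.aemeasurable
  have := Measure.isProbabilityMeasure_map (μ := μ) hZ.aemeasurable
  have hprod := (indepFun_iff_map_prod_eq_prod_map_map (by fun_prop) (by fun_prop)).1 hi.symm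
  rw [← lintegral_indicator (hZ hB), ← lintegral_indicator (hZ hB)]
  have hm : Measurable fun p : α × EuclideanSpace ℝ (Fin M) =>
      B.indicator (fun _ => (1 : ENNReal)) p.1 * ‖p.2 + g p.1‖ₑ ^ 2 :=
    ((measurable_const.indicator hB).comp measurable_fst).mul (by fun_prop)
  have hm2 : Measurable fun z : α => B.indicator (fun _ => (1 : ENNReal)) z *
      (ENNReal.ofReal P.trace + ‖g z‖ₑ ^ 2) :=
    (measurable_const.indicator hB).mul (by fun_prop)
  -- By independence the integral is taken against a product law, so `z` can be frozen and the
  -- constant-shift case applied to the inner integral.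
  calc ∫⁻ ω, (Z ⁻¹' B).indicator (fun ω => ‖e ω + g (Z ω)‖ₑ ^ 2) ω ∂μ
      = ∫⁻ ω, B.indicator (fun _ => (1 : ENNReal)) (Z ω) * ‖e ω + g (Z ω)‖ₑ ^ 2 ∂μ := by
        refine lintegral_congr fun ω => ?_
        by_cases hω : Z ω ∈ B <;> simp [hω]
    _ = ∫⁻ p, B.indicator (fun _ => (1 : ENNReal)) p.1 * ‖p.2 + g p.1‖ₑ ^ 2
          ∂(μ.map fun ω => (Z ω, e ω)) := (lintegral_map hm (hZ.prodMk he)).symm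
    _ = ∫⁻ z, ∫⁻ v, B.indicator (fun _ => (1 : ENNReal)) z * ‖v + g z‖ₑ ^ 2 ∂(μ.map e)
          ∂(μ.map Z) := by rw [hprod, lintegral_prod _ hm.aemeasurable]
    _ = ∫⁻ z, B.indicator (fun _ => (1 : ENNReal)) z *
          (ENNReal.ofReal P.trace + ‖g z‖ₑ ^ 2) ∂(μ.map Z) := by
        refine lintegral_congr fun z => ?_
        rw [lintegral_const_mul _ (by fun_prop), lintegral_map (by fun_prop) he,
          h.lintegral_enorm_add_sq hP]
    _ = ∫⁻ ω, B.indicator (fun _ => (1 : ENNReal)) (Z ω) *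
          (ENNReal.ofReal P.trace + ‖g (Z ω)‖ₑ ^ 2) ∂μ := lintegral_map hm2 hZ
    _ = _ := by
        refine lintegral_congr fun ω => ?_
        by_cases hω : Z ω ∈ B <;> simp [hω]

end IsCenteredGaussian

/-! ### The Kalman estimator along a schedule -/

/-- The one-step prediction of the state at time `t` from the samples `y 0, …, y (t - 1)` taken
under the schedule `c`. As the increments are centered, this is also the estimate at `t - 1`. -/
noncomputable def kalmanMean {M : ℕ} (Q P₀ : Matrix (Fin M) (Fin M) ℝ)
    (xhat₀ : EuclideanSpace ℝ (Fin M)) (c : ℕ → Fin M) (y : ℕ → ℝ) :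
    ℕ → EuclideanSpace ℝ (Fin M)
  | 0 => xhat₀
  | t + 1 => kalmanMean Q P₀ xhat₀ c y t +
      (y t - kalmanMean Q P₀ xhat₀ c y t (c t)) • kalmanGain (kalmanCov Q P₀ c t) (c t)

section Schedule

variable {M : ℕ} (Q P₀ : Matrix (Fin M) (Fin M) ℝ) (xhat₀ : EuclideanSpace ℝ (Fin M))

lemma kalmanMean_congr {c d : ℕ → Fin M} {y z : ℕ → ℝ} {t : ℕ} (hc : ∀ k < t, c k = d k)
    (hy : ∀ k < t, y k = z k) :
    kalmanMean Q P₀ xhat₀ c y t = kalmanMean Q P₀ xhat₀ d z t := by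
  induction t with
  | zero => rfl
  | succ t ih =>
    rw [kalmanMean, kalmanMean, ih (fun k hk => hc k (by omega)) (fun k hk => hy k (by omega)),
      hc t (by omega), hy t (by omega), kalmanCov_congr Q P₀ fun k hk => hc k (by omega)]

lemma measurable_kalmanMean (c : ℕ → Fin M) (t : ℕ) :
    Measurable fun y : ℕ → ℝ => kalmanMean Q P₀ xhat₀ c y t := by
  induction t with
  | zero => exact measurable_const
  | succ t ih =>
    simp only [kalmanMean]
    fun_prop

/-- What the monitor receives before time `t` under the schedule `c`. -/
def scheduleHistory (c : ℕ → Fin M) (x : ℕ → EuclideanSpace ℝ (Fin M)) (t : ℕ) : History M t :=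
  fun k => (c k, x k (c k))

/-- The schedule recorded in a history, continued by `i₀`. -/
def History.schedule (i₀ : Fin M) {t : ℕ} (h : History M t) (k : ℕ) : Fin M :=
  if hk : k < t then (h ⟨k, hk⟩).1 else i₀

/-- The samples recorded in a history, continued by `0`. -/
noncomputable def History.samples {t : ℕ} (h : History M t) (k : ℕ) : ℝ :=
  if hk : k < t then (h ⟨k, hk⟩).2 else 0

lemma History.measurable_samples {t : ℕ} :
    Measurable fun h : History M t => h.samples := by
  refine measurable_pi_iff.2 fun k => ?_
  unfold History.samples
  split_ifs with hk
  · exact (measurable_pi_apply _).snd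
  · exact measurable_const

/-- The Kalman estimate as a function of the history. -/
noncomputable def History.kalmanEstimate (i₀ : Fin M) {t : ℕ} (h : History M t) :
    EuclideanSpace ℝ (Fin M) :=
  kalmanMean Q P₀ xhat₀ (h.schedule i₀) h.samples t

/-- There are only finitely many recorded schedules, and for each one the estimate is measurable in
the samples. -/
lemma History.measurable_kalmanEstimate (i₀ : Fin M) (t : ℕ) :
    Measurable fun h : History M t => h.kalmanEstimate Q P₀ xhat₀ i₀ := by
  have h1 : Measurable fun p : (Fin t → Fin M) × (ℕ → ℝ) =>
      kalmanMean Q P₀ xhat₀ (fun k => if hk : k < t then p.1 ⟨k, hk⟩ else i₀) p.2 t :=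
    measurable_from_prod_countable_right fun c => measurable_kalmanMean Q P₀ xhat₀
      (fun k => if hk : k < t then c ⟨k, hk⟩ else i₀) t
  have h2 : Measurable fun h : History M t => ((fun k => (h k).1 : Fin t → Fin M), h.samples) :=
    (measurable_pi_iff.2 fun k => (measurable_pi_apply k).fst).prodMk History.measurable_samples
  exact h1.comp h2

lemma kalmanEstimate_scheduleHistory (i₀ : Fin M) (c : ℕ → Fin M)
    (x : ℕ → EuclideanSpace ℝ (Fin M)) (t : ℕ) :
    (scheduleHistory c x t).kalmanEstimate Q P₀ xhat₀ i₀ =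
      kalmanMean Q P₀ xhat₀ c (fun k => x k (c k)) t :=
  kalmanMean_congr Q P₀ xhat₀ (fun k hk => by simp [History.schedule, scheduleHistory, hk])
    (fun k hk => by simp [History.samples, scheduleHistory, hk])

end Schedule

/-- Since the sample is noiseless, the innovation is the observed coordinate of the prediction
error, so the filter acts on the error as the residual map. -/
lemma kalman_error_update {M : ℕ} (Q P₀ : Matrix (Fin M) (Fin M) ℝ)
    (xhat₀ : EuclideanSpace ℝ (Fin M)) (c : ℕ → Fin M) (x : ℕ → EuclideanSpace ℝ (Fin M)) (t : ℕ) :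
    x t - kalmanMean Q P₀ xhat₀ c (fun k => x k (c k)) (t + 1) =
      (x t - kalmanMean Q P₀ xhat₀ c (fun k => x k (c k)) t) -
        (x t - kalmanMean Q P₀ xhat₀ c (fun k => x k (c k)) t) (c t) •
          kalmanGain (kalmanCov Q P₀ c t) (c t) := by
  rw [kalmanMean, PiLp.sub_apply]
  abel

/-! ### The law of the estimation error under a deterministic schedule -/

section Law

variable {M : ℕ} {Ω S : Type*} [MeasurableSpace Ω] [MeasurableSpace S]
  {μ : Measure Ω} {Q P₀ : Matrix (Fin M) (Fin M) ℝ} {xhat₀ : EuclideanSpace ℝ (Fin M)}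
  {x₀ : Ω → EuclideanSpace ℝ (Fin M)} {w : ℕ → Ω → EuclideanSpace ℝ (Fin M)} {ξ : Ω → S}

lemma IsSourceModel.measurable_stateAt (h : IsSourceModel μ Q P₀ xhat₀ x₀ w ξ) (t : ℕ) :
    Measurable (stateAt x₀ w t) := by
  induction t with
  | zero => exact h.measurable_init
  | succ t ih => exact ih.add (h.measurable_incr t)

lemma measurable_scheduleHistory {c : ℕ → Fin M} {x : ℕ → Ω → EuclideanSpace ℝ (Fin M)}
    {t : ℕ} (hx : ∀ k < t, Measurable (x k)) :
    Measurable fun ω => scheduleHistory c (fun k => x k ω) t := by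
  refine measurable_pi_iff.2 fun k => measurable_const.prodMk ?_
  have := hx k k.2
  fun_prop

/-- The state before time `t + 1` as a function of the inputs before time `t`. -/
noncomputable def stateOfInputs (t : ℕ)
    (p : S × EuclideanSpace ℝ (Fin M) × (Finset.range t → EuclideanSpace ℝ (Fin M))) (k : ℕ) :
    EuclideanSpace ℝ (Fin M) :=
  stateAt (fun p => p.2.1)
    (fun j p => if hj : j ∈ Finset.range t then p.2.2 ⟨j, hj⟩ else (0 : EuclideanSpace ℝ (Fin M)))
    k p

lemma measurable_stateOfInputs (t k : ℕ) :
    Measurable fun p : S × EuclideanSpace ℝ (Fin M) ×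
      (Finset.range t → EuclideanSpace ℝ (Fin M)) => stateOfInputs t p k := by
  induction k with
  | zero => exact measurable_snd.fst
  | succ k ih =>
    refine ih.add ?_
    dsimp only
    split_ifs with hk
    · exact (measurable_pi_apply _).comp measurable_snd.snd
    · exact measurable_const

omit [MeasurableSpace Ω] [MeasurableSpace S] in
lemma stateOfInputs_eq (t : ℕ) {k : ℕ} (hk : k ≤ t) (ω : Ω) :
    stateOfInputs t (ξ ω, x₀ ω, fun j : Finset.range t => w j ω) k = stateAt x₀ w k ω := by
  induction k with
  | zero => rfl
  | succ k ih =>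
    have h := ih (by omega)
    simp only [stateOfInputs] at h ⊢
    simp only [stateAt, h]
    rw [dif_pos (Finset.mem_range.2 (by omega))]

/-- The past increments, the initial state and the seed are adjoined in turn, each being independent
of everything adjoined before it together with `w t`. -/
lemma IsSourceModel.indepFun_incr_inputs [IsProbabilityMeasure μ]
    (h : IsSourceModel μ Q P₀ xhat₀ x₀ w ξ) (t : ℕ) :
    IndepFun (w t) (fun ω => (ξ ω, x₀ ω, fun j : Finset.range t => w j ω)) μ := by
  have hw := h.measurable_incr
  have hx := h.measurable_init
  have hξ := h.measurable_seed
  have hpast : Measurable fun ω => fun j : Finset.range t => w j ω :=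
    measurable_pi_iff.2 fun j => hw j
  have hsingle : Measurable fun f : (∀ _ : ({t} : Finset ℕ), EuclideanSpace ℝ (Fin M)) =>
      f ⟨t, Finset.mem_singleton_self t⟩ := measurable_pi_apply _
  have h1 : IndepFun (w t) (fun ω => fun j : Finset.range t => w j ω) μ :=
    (h.incr_indep.indepFun_finset {t} (Finset.range t) (by simp) hw).comp hsingle measurable_id
  have h2 : IndepFun x₀ (fun ω => (w t ω, fun j : Finset.range t => w j ω)) μ :=
    h.init_indep_incr.comp (φ := id)
      (ψ := fun f : ℕ → EuclideanSpace ℝ (Fin M) => (f t, fun j : Finset.range t => f j))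
      measurable_id (by fun_prop)
  have h3 : IndepFun (w t) (fun ω => ((fun j : Finset.range t => w j ω), x₀ ω)) μ :=
    h1.indepFun_prodMk_of_indepFun_prodMk (hw t) hpast hx h2
  have h4 : IndepFun ξ (fun ω => (w t ω, ((fun j : Finset.range t => w j ω), x₀ ω))) μ :=
    h.seed_indep.comp (φ := id)
      (ψ := fun p : EuclideanSpace ℝ (Fin M) × (ℕ → EuclideanSpace ℝ (Fin M)) =>
        (p.2 t, ((fun j : Finset.range t => p.2 j), p.1))) measurable_id (by fun_prop)
  have h5 := h3.indepFun_prodMk_of_indepFun_prodMk (hw t) (hpast.prodMk hx) hξ h4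
  exact h5.comp (φ := id) (ψ := fun p : ((Finset.range t → EuclideanSpace ℝ (Fin M)) ×
    EuclideanSpace ℝ (Fin M)) × S => (p.2, p.1.2, p.1.1)) measurable_id (by fun_prop)

/-- The increment at time `t` is independent of the seed and the states up to time `t`. -/
lemma IsSourceModel.indepFun_incr_state [IsProbabilityMeasure μ]
    (h : IsSourceModel μ Q P₀ xhat₀ x₀ w ξ) (t : ℕ) :
    IndepFun (w t) (fun ω => (ξ ω, fun k : Fin (t + 1) => stateAt x₀ w k ω)) μ := by
  have hm : Measurable fun p : S × EuclideanSpace ℝ (Fin M) ×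
      (Finset.range t → EuclideanSpace ℝ (Fin M)) =>
      (p.1, fun k : Fin (t + 1) => stateOfInputs t p k) :=
    measurable_fst.prodMk (measurable_pi_iff.2 fun k : Fin (t + 1) =>
      measurable_stateOfInputs t (k : ℕ))
  have h1 := (h.indepFun_incr_inputs t).comp measurable_id hm
  have h2 : (fun ω => (ξ ω, fun k : Fin (t + 1) => stateAt x₀ w k ω)) =
      (fun p => (p.1, fun k : Fin (t + 1) => stateOfInputs t p k)) ∘
        (fun ω => (ξ ω, x₀ ω, fun j : Finset.range t => w j ω)) := by
    funext ω
    simp only [Function.comp_apply, Prod.mk.injEq, true_and]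
    funext k
    rw [stateOfInputs_eq t (by omega)]
  rw [h2]
  exact h1

/-- The next history from the innovation and the previous history. -/
noncomputable def historyOfInnovation (Q P₀ : Matrix (Fin M) (Fin M) ℝ)
    (xhat₀ : EuclideanSpace ℝ (Fin M)) (c : ℕ → Fin M) (t : ℕ) (p : ℝ × S × History M t) :
    S × History M (t + 1) :=
  (p.2.1, fun k => if hk : (k : ℕ) < t then p.2.2 ⟨k, hk⟩ else
    (c t, p.1 + p.2.2.kalmanEstimate Q P₀ xhat₀ (c 0) (c t)))

lemma measurable_historyOfInnovation (c : ℕ → Fin M) (t : ℕ) :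
    Measurable (historyOfInnovation (S := S) Q P₀ xhat₀ c t) := by
  refine measurable_snd.fst.prodMk (measurable_pi_iff.2 fun k => ?_)
  split_ifs with hk
  · exact (measurable_pi_apply _).comp measurable_snd.snd
  · refine measurable_const.prodMk (measurable_fst.add ?_)
    have := (History.measurable_kalmanEstimate Q P₀ xhat₀ (c 0) t).comp
      (measurable_snd.comp measurable_snd : Measurable fun p : ℝ × S × History M t => p.2.2)
    exact (EuclideanSpace.proj (𝕜 := ℝ) (c t)).continuous.measurable.comp this

-- The new sample is the innovation plus a predicted coordinate that the old data determine, so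
-- innovation and old data carry all the information in the new history.
omit [MeasurableSpace S] in
lemma historyOfInnovation_eq (c : ℕ → Fin M) (t : ℕ) (s : S)
    (x : ℕ → EuclideanSpace ℝ (Fin M)) :
    historyOfInnovation Q P₀ xhat₀ c t
      ((x t - kalmanMean Q P₀ xhat₀ c (fun k => x k (c k)) t) (c t), s, scheduleHistory c x t) =
      (s, scheduleHistory c x (t + 1)) := by
  simp only [historyOfInnovation, Prod.mk.injEq, true_and, kalmanEstimate_scheduleHistory]
  funext k
  split_ifs with hk
  · rfl
  · have : (k : ℕ) = t := by omega
    simp [scheduleHistory, this]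

variable [IsProbabilityMeasure μ]

omit [IsProbabilityMeasure μ] in
lemma IsSourceModel.measurable_kalmanError (h : IsSourceModel μ Q P₀ xhat₀ x₀ w ξ)
    (c : ℕ → Fin M) (t s : ℕ) :
    Measurable fun ω => stateAt x₀ w t ω -
      kalmanMean Q P₀ xhat₀ c (fun k => stateAt x₀ w k ω (c k)) s := by
  refine (h.measurable_stateAt t).sub ((measurable_kalmanMean Q P₀ xhat₀ c s).comp
    (measurable_pi_iff.2 fun k => ?_))
  have := h.measurable_stateAt k
  fun_prop

/-- One step of the filter: the error after the sample at time `t` is independent of everything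
received up to that time. -/
lemma IsSourceModel.indepFun_update (h : IsSourceModel μ Q P₀ xhat₀ x₀ w ξ)
    (hQ : Q.PosSemidef) (hP₀ : P₀.PosSemidef) (c : ℕ → Fin M) (t : ℕ)
    (hg : IsCenteredGaussian μ (fun ω => stateAt x₀ w t ω -
      kalmanMean Q P₀ xhat₀ c (fun k => stateAt x₀ w k ω (c k)) t) (kalmanCov Q P₀ c t))
    (hi : IndepFun (fun ω => stateAt x₀ w t ω -
      kalmanMean Q P₀ xhat₀ c (fun k => stateAt x₀ w k ω (c k)) t)
      (fun ω => (ξ ω, scheduleHistory c (fun k => stateAt x₀ w k ω) t)) μ) :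
    IndepFun (fun ω => stateAt x₀ w t ω -
      kalmanMean Q P₀ xhat₀ c (fun k => stateAt x₀ w k ω (c k)) (t + 1))
      (fun ω => (ξ ω, scheduleHistory c (fun k => stateAt x₀ w k ω) (t + 1))) μ := by
  have hupd := hg.indepFun_update (posSemidef_kalmanCov hQ hP₀ c t) (c t)
  have hξ := h.measurable_seed
  have hme := h.measurable_kalmanError c t t
  have hH : Measurable fun ω => (ξ ω, scheduleHistory c (fun k => stateAt x₀ w k ω) t) :=
    hξ.prodMk (measurable_scheduleHistory fun k _ => h.measurable_stateAt k)
  set e := fun ω => stateAt x₀ w t ω -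
      kalmanMean Q P₀ xhat₀ c (fun k => stateAt x₀ w k ω (c k)) t with he
  have hK : Measurable (fun ω => e ω - e ω (c t) • kalmanGain (kalmanCov Q P₀ c t) (c t)) ∧
      Measurable (fun ω => e ω (c t)) := by
    clear_value e
    constructor <;> fun_prop
  have h1 : IndepFun (fun ω => (ξ ω, scheduleHistory c (fun k => stateAt x₀ w k ω) t))
      (fun ω => (e ω - e ω (c t) • kalmanGain (kalmanCov Q P₀ c t) (c t), e ω (c t))) μ :=
    hi.symm.comp (φ := id) (ψ := fun z : EuclideanSpace ℝ (Fin M) =>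
      (z - z (c t) • kalmanGain (kalmanCov Q P₀ c t) (c t), z (c t)))
      measurable_id (by fun_prop)
  -- The residual is independent of the innovation, and the old data are independent of both; hence
  -- the residual is independent of innovation and old data together, which determine the new data.
  have h2 := hupd.indepFun_prodMk_of_indepFun_prodMk hK.1 hK.2 hH h1
  have h3 := h2.comp measurable_id
    (measurable_historyOfInnovation (S := S) (Q := Q) (P₀ := P₀) (xhat₀ := xhat₀) c t)
  convert h3 using 1
  · funext ω
    exact kalman_error_update Q P₀ xhat₀ c (fun k => stateAt x₀ w k ω) t
  · funext ω
    exact (historyOfInnovation_eq c t (ξ ω) (fun k => stateAt x₀ w k ω)).symm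

lemma IsCenteredGaussian.kalman_update
    (hQ : Q.PosSemidef) (hP₀ : P₀.PosSemidef) (c : ℕ → Fin M) (t : ℕ)
    (hg : IsCenteredGaussian μ (fun ω => stateAt x₀ w t ω -
      kalmanMean Q P₀ xhat₀ c (fun k => stateAt x₀ w k ω (c k)) t) (kalmanCov Q P₀ c t)) :
    IsCenteredGaussian μ (fun ω => stateAt x₀ w t ω -
      kalmanMean Q P₀ xhat₀ c (fun k => stateAt x₀ w k ω (c k)) (t + 1))
      (postCov (kalmanCov Q P₀ c t) (c t)) := by
  have := hg.update (posSemidef_kalmanCov hQ hP₀ c t) (c t)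
  convert this using 1
  funext ω
  exact kalman_error_update Q P₀ xhat₀ c (fun k => stateAt x₀ w k ω) t

/-- The prediction error is Gaussian with the Kalman covariance, and independent of everything
received so far. -/
lemma IsSourceModel.kalman_prediction (h : IsSourceModel μ Q P₀ xhat₀ x₀ w ξ)
    (hQ : Q.PosSemidef) (hP₀ : P₀.PosSemidef) (c : ℕ → Fin M) (t : ℕ) :
    IsCenteredGaussian μ (fun ω => stateAt x₀ w t ω -
      kalmanMean Q P₀ xhat₀ c (fun k => stateAt x₀ w k ω (c k)) t) (kalmanCov Q P₀ c t) ∧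
    IndepFun (fun ω => stateAt x₀ w t ω -
      kalmanMean Q P₀ xhat₀ c (fun k => stateAt x₀ w k ω (c k)) t)
      (fun ω => (ξ ω, scheduleHistory c (fun k => stateAt x₀ w k ω) t)) μ := by
  have hξ := h.measurable_seed
  have hx := h.measurable_init
  induction t with
  | zero =>
    refine ⟨IsCenteredGaussian.of_hasLaw hP₀ h.init_law, ?_⟩
    exact (h.seed_indep.comp (φ := fun s => (s, (Fin.elim0 : History M 0)))
      (ψ := fun p : EuclideanSpace ℝ (Fin M) × (ℕ → EuclideanSpace ℝ (Fin M)) => p.1 - xhat₀)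
      (by fun_prop) (by fun_prop)).symm.congr (ae_of_all _ fun ω => rfl)
      (ae_of_all _ fun ω => Prod.ext rfl (funext fun k => k.elim0))
  | succ t ih =>
    have hg := IsCenteredGaussian.kalman_update hQ hP₀ c t ih.1
    have hi := h.indepFun_update hQ hP₀ c t ih.1 ih.2
    have hme := h.measurable_kalmanError c t (t + 1)
    have hH : Measurable fun ω => (ξ ω, scheduleHistory c (fun k => stateAt x₀ w k ω) (t + 1)) :=
      hξ.prodMk (measurable_scheduleHistory fun k _ => h.measurable_stateAt k)
    have hw : IsCenteredGaussian μ (w t) Q := by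
      simpa using IsCenteredGaussian.of_hasLaw hQ (h.incr_law t)
    -- the new increment is independent of the error and the received data
    have hwi : IndepFun (w t) (fun ω =>
        ((ξ ω, scheduleHistory c (fun k => stateAt x₀ w k ω) (t + 1)), stateAt x₀ w t ω -
          kalmanMean Q P₀ xhat₀ c (fun k => stateAt x₀ w k ω (c k)) (t + 1))) μ := by
      have hsh : Measurable fun p : S × (Fin (t + 1) → EuclideanSpace ℝ (Fin M)) =>
          ((fun k => (c k, p.2 k (c k))) : History M (t + 1)) :=
        measurable_pi_iff.2 fun k => measurable_const.prodMk (by fun_prop)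
      have hmap : Measurable fun p : S × (Fin (t + 1) → EuclideanSpace ℝ (Fin M)) =>
          ((p.1, ((fun k => (c k, p.2 k (c k))) : History M (t + 1))), p.2 (Fin.last t) -
            History.kalmanEstimate Q P₀ xhat₀ (c 0)
              ((fun k => (c k, p.2 k (c k))) : History M (t + 1))) :=
        (measurable_fst.prodMk hsh).prodMk (Measurable.sub (by fun_prop)
          ((History.measurable_kalmanEstimate Q P₀ xhat₀ (c 0) (t + 1)).comp hsh))
      refine ((h.indepFun_incr_state t).comp measurable_id hmap).congr
        (ae_of_all _ fun ω => rfl) (ae_of_all _ fun ω => Prod.ext rfl ?_)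
      exact congrArg (stateAt x₀ w t ω - ·) (kalmanEstimate_scheduleHistory Q P₀ xhat₀ (c 0) c
        (fun k => stateAt x₀ w k ω) (t + 1))
    have hsum : ∀ ω, stateAt x₀ w (t + 1) ω -
        kalmanMean Q P₀ xhat₀ c (fun k => stateAt x₀ w k ω (c k)) (t + 1) =
        (stateAt x₀ w t ω -
          kalmanMean Q P₀ xhat₀ c (fun k => stateAt x₀ w k ω (c k)) (t + 1)) + w t ω := by
      intro ω; simp only [stateAt]; abel
    simp only [hsum]
    refine ⟨?_, ?_⟩
    · rw [kalmanCov_succ]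
      exact hg.add hw (hwi.comp (ψ := Prod.snd) measurable_id measurable_snd).symm
    -- The data are independent of the pair of posterior error and new increment, hence of their
    -- sum.
    · have := hi.symm.indepFun_prodMk_of_indepFun_prodMk hH hme (h.measurable_incr t) hwi
      exact (this.comp (φ := id) (ψ := fun p : EuclideanSpace ℝ (Fin M) × EuclideanSpace ℝ (Fin M)
        => p.1 + p.2) measurable_id (by fun_prop)).symm

end Law

/-! ### The error of an oblivious policy -/

section Policy

variable {M : ℕ} {S : Type*} [MeasurableSpace S]

lemma ObliviousPolicy.history_eq (π : ObliviousPolicy M S) (s : S)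
    (x : ℕ → EuclideanSpace ℝ (Fin M)) (t : ℕ) :
    π.history s x t = fun k : Fin t => (π.sensor s x k, x k (π.sensor s x k)) := by
  induction t with
  | zero => funext k; exact k.elim0
  | succ t ih =>
    funext k
    refine Fin.lastCases ?_ (fun j => ?_) k
    · simp [ObliviousPolicy.history, ObliviousPolicy.sensor]
    · simp only [ObliviousPolicy.history, Fin.snoc_castSucc]
      rw [ih]
      rfl

lemma ObliviousPolicy.history_eq_scheduleHistory (π : ObliviousPolicy M S) (s : S)
    (x : ℕ → EuclideanSpace ℝ (Fin M)) (c : ℕ → Fin M) {t : ℕ}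
    (h : ∀ k < t, π.sensor s x k = c k) : π.history s x t = scheduleHistory c x t := by
  rw [π.history_eq]
  funext k
  simp [scheduleHistory, h k k.2]

/-- A policy follows the schedule `c` if and only if its decisions on the data received under `c`
agree with `c`. -/
lemma ObliviousPolicy.sensor_eq_iff (π : ObliviousPolicy M S) (s : S)
    (x : ℕ → EuclideanSpace ℝ (Fin M)) (c : ℕ → Fin M) (t : ℕ) :
    (∀ k < t, π.sensor s x k = c k) ↔
      ∀ k < t, π.decide k (s, scheduleHistory c x k) = c k := by
  induction t with
  | zero => simp
  | succ t ih =>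
    simp only [Nat.lt_succ_iff_lt_or_eq, or_imp, forall_and, forall_eq]
    rw [← ih]
    -- Once the decisions agree so far, the policy's own history is the one received under `c`, so
    -- the next decisions coincide.
    refine and_congr_right fun h => ?_
    rw [← π.history_eq_scheduleHistory s x c h]
    rfl

/-- The received data on which the policy follows the schedule `c` before time `t`. -/
def ObliviousPolicy.followSet (π : ObliviousPolicy M S) (c : ℕ → Fin M) (t : ℕ) :
    Set (S × History M t) :=
  {p | ∀ k : Fin t, π.decide k (p.1, fun l : Fin k => p.2 ⟨l, l.2.trans k.2⟩) = c k}

lemma ObliviousPolicy.measurableSet_followSet (π : ObliviousPolicy M S) (c : ℕ → Fin M) (t : ℕ) :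
    MeasurableSet (π.followSet c t) := by
  have : π.followSet c t = ⋂ k : Fin t,
      (fun p : S × History M t =>
        π.decide k (p.1, fun l : Fin k => p.2 ⟨l, l.2.trans k.2⟩)) ⁻¹' {c k} := by
    ext p; simp [ObliviousPolicy.followSet]
  rw [this]
  refine MeasurableSet.iInter fun k => ?_
  have hm : Measurable fun p : S × History M t =>
      ((p.1, fun l : Fin k => p.2 ⟨l, l.2.trans k.2⟩) : S × History M k) :=
    measurable_fst.prodMk (measurable_pi_iff.2 fun l =>
      (measurable_pi_apply _).comp measurable_snd)
  exact (π.measurable_decide k).comp hm (measurableSet_singleton _)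

lemma ObliviousPolicy.mem_followSet_iff (π : ObliviousPolicy M S) (s : S)
    (x : ℕ → EuclideanSpace ℝ (Fin M)) (c : ℕ → Fin M) (t : ℕ) :
    (s, scheduleHistory c x t) ∈ π.followSet c t ↔ ∀ k < t, π.sensor s x k = c k := by
  rw [π.sensor_eq_iff]
  exact ⟨fun h k hk => h ⟨k, hk⟩, fun h k => h k k.2⟩

variable {Ω : Type*} [MeasurableSpace Ω]

lemma measurable_eval_index {x : Ω → EuclideanSpace ℝ (Fin M)} {i : Ω → Fin M}
    (hx : Measurable x) (hi : Measurable i) : Measurable fun ω => x ω (i ω) := by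
  have h : Measurable fun p : Fin M × EuclideanSpace ℝ (Fin M) => p.2 p.1 :=
    measurable_from_prod_countable_right fun j => by
      change Measurable fun z : EuclideanSpace ℝ (Fin M) => z j
      fun_prop
  exact h.comp (hi.prodMk hx)

lemma ObliviousPolicy.measurable_sensor (π : ObliviousPolicy M S) {ξ : Ω → S}
    {x : ℕ → Ω → EuclideanSpace ℝ (Fin M)} (hξ : Measurable ξ) (hx : ∀ t, Measurable (x t))
    (t : ℕ) : Measurable fun ω => π.sensor (ξ ω) (fun k => x k ω) t := by
  induction t using Nat.strong_induction_on with
  | _ t ih =>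
    refine (π.measurable_decide t).comp (hξ.prodMk ?_)
    simp only [π.history_eq]
    exact measurable_pi_iff.2 fun k =>
      (ih k k.2).prodMk (measurable_eval_index (hx k) (ih k k.2))

/-- Any function of finitely many scheduling decisions is measurable. -/
lemma ObliviousPolicy.measurable_comp_sensor (π : ObliviousPolicy M S) {ξ : Ω → S}
    {x : ℕ → Ω → EuclideanSpace ℝ (Fin M)} (hξ : Measurable ξ) (hx : ∀ t, Measurable (x t))
    {α : Type*} [MeasurableSpace α] (i₀ : Fin M) (f : (ℕ → Fin M) → α) (t : ℕ)
    (hf : ∀ c d : ℕ → Fin M, (∀ k < t, c k = d k) → f c = f d) :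
    Measurable fun ω => f (π.sensor (ξ ω) (fun k => x k ω)) := by
  have h1 : Measurable fun ω => fun k : Fin t => π.sensor (ξ ω) (fun k => x k ω) k :=
    measurable_pi_iff.2 fun k => π.measurable_sensor hξ hx k
  have h2 : Measurable fun d : Fin t → Fin M => f fun k => if hk : k < t then d ⟨k, hk⟩ else i₀ :=
    measurable_of_finite _
  convert h2.comp h1 using 1
  funext ω
  exact hf _ _ fun k hk => by simp [hk]

/-- Bias-variance decomposition of the error of a policy with an arbitrary estimator. -/
lemma IsSourceModel.lintegral_error_eq {μ : Measure Ω} [IsProbabilityMeasure μ]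
    {Q P₀ : Matrix (Fin M) (Fin M) ℝ} {xhat₀ : EuclideanSpace ℝ (Fin M)}
    {x₀ : Ω → EuclideanSpace ℝ (Fin M)} {w : ℕ → Ω → EuclideanSpace ℝ (Fin M)} {ξ : Ω → S}
    (h : IsSourceModel μ Q P₀ xhat₀ x₀ w ξ) (hQ : Q.PosSemidef) (hP₀ : P₀.PosSemidef)
    (i₀ : Fin M) (π : ObliviousPolicy M S) (t : ℕ)
    {η : History M (t + 1) → EuclideanSpace ℝ (Fin M)} (hη : Measurable η) :
    ∫⁻ ω, ‖stateAt x₀ w t ω -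
        η (π.history (ξ ω) (fun k => stateAt x₀ w k ω) (t + 1))‖ₑ ^ 2 ∂μ =
      ∫⁻ ω, (ENNReal.ofReal (postCov
          (kalmanCov Q P₀ (π.sensor (ξ ω) (fun k => stateAt x₀ w k ω)) t)
          (π.sensor (ξ ω) (fun k => stateAt x₀ w k ω) t)).trace +
        ‖(π.history (ξ ω) (fun k => stateAt x₀ w k ω) (t + 1)).kalmanEstimate Q P₀ xhat₀ i₀ -
          η (π.history (ξ ω) (fun k => stateAt x₀ w k ω) (t + 1))‖ₑ ^ 2) ∂μ := by
  have hξ := h.measurable_seed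
  -- Patterns of the first `t + 1` decisions index a finite partition of the sample space; the
  -- continuation by `i₀` plays no role.
  set sched : (Fin (t + 1) → Fin M) → ℕ → Fin M :=
    fun d k => if hk : k < t + 1 then d ⟨k, hk⟩ else i₀ with hsched
  have hsched_coe : ∀ d (k : Fin (t + 1)), sched d k = d k := fun d k => dif_pos k.2
  set Z : (Fin (t + 1) → Fin M) → Ω → S × History M (t + 1) := fun d ω =>
    (ξ ω, scheduleHistory (sched d) (fun k => stateAt x₀ w k ω) (t + 1)) with hZdef
  set E : (Fin (t + 1) → Fin M) → Set Ω := fun d => Z d ⁻¹' π.followSet (sched d) (t + 1)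
    with hEdef
  have hmem : ∀ d ω, ω ∈ E d ↔
      ∀ k < t + 1, π.sensor (ξ ω) (fun k => stateAt x₀ w k ω) k = sched d k := fun d ω =>
    π.mem_followSet_iff _ _ _ _
  have hZ : ∀ d, Measurable (Z d) := fun d =>
    hξ.prodMk (measurable_scheduleHistory fun k _ => h.measurable_stateAt k)
  have hE : ∀ d, MeasurableSet (E d) := fun d => hZ d (π.measurableSet_followSet _ _)
  have hdisj : Pairwise (Function.onFun Disjoint E) := by
    intro d d' hne
    refine Set.disjoint_left.2 fun ω h1 h2 => hne (funext fun k => ?_)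
    have h3 := ((hmem d ω).1 h1 k k.2).symm.trans ((hmem d' ω).1 h2 k k.2)
    rwa [hsched_coe, hsched_coe] at h3
  have hunion : ⋃ d, E d = Set.univ := by
    refine Set.eq_univ_of_forall fun ω => ?_
    set d : Fin (t + 1) → Fin M := fun k => π.sensor (ξ ω) (fun k => stateAt x₀ w k ω) k
    exact Set.mem_iUnion_of_mem d ((hmem d ω).2 fun k hk => (hsched_coe d ⟨k, hk⟩).symm)
  have hsplit : ∀ f : Ω → ENNReal, ∫⁻ ω, f ω ∂μ = ∑' d, ∫⁻ ω in E d, f ω ∂μ := by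
    intro f
    rw [← lintegral_iUnion hE hdisj, hunion, setLIntegral_univ]
  rw [hsplit, hsplit]
  refine tsum_congr fun d => ?_
  have hpred := h.kalman_prediction hQ hP₀ (sched d) t
  have hg := IsCenteredGaussian.kalman_update hQ hP₀ (sched d) t hpred.1
  have hi := h.indepFun_update hQ hP₀ (sched d) t hpred.1 hpred.2
  have hbias : Measurable fun p : S × History M (t + 1) =>
      p.2.kalmanEstimate Q P₀ xhat₀ i₀ - η p.2 :=
    ((History.measurable_kalmanEstimate Q P₀ xhat₀ i₀ (t + 1)).comp measurable_snd).sub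
      (hη.comp measurable_snd)
  -- `E d` is a preimage under the data `Z d`, of which the posterior error for the schedule of `d`
  -- is independent; restricting to it therefore creates no bias.
  have key := hg.setLIntegral_enorm_add_sq
    (posSemidef_postCov (posSemidef_kalmanCov hQ hP₀ _ _) _)
    (h.measurable_kalmanError (sched d) t (t + 1)) (hZ d) hi
    (π.measurableSet_followSet (sched d) (t + 1)) hbias
  have hhist : ∀ ω ∈ E d, π.history (ξ ω) (fun k => stateAt x₀ w k ω) (t + 1) = (Z d ω).2 :=
    fun ω hω => π.history_eq_scheduleHistory _ _ _ ((hmem d ω).1 hω)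
  refine Eq.trans (setLIntegral_congr_fun (hE d) fun ω hω => ?_)
    (key.trans (setLIntegral_congr_fun (hE d) fun ω hω => ?_))
  · dsimp only
    rw [hhist ω hω, ← kalmanEstimate_scheduleHistory Q P₀ xhat₀ i₀]
    congr 2
    simp only [hZdef]
    abel
  · rw [hhist ω hω, kalmanCov_congr Q P₀ fun k hk => (hmem d ω).1 hω k (by omega),
      (hmem d ω).1 hω t (by omega)]

end Policy

/-! ### Averages with bounded corrections -/

lemma ENNReal.inv_natCast_mul_ofReal {T : ℕ} (hT : 1 ≤ T) (x : ℝ) :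
    (T : ENNReal)⁻¹ * ENNReal.ofReal x = ENNReal.ofReal (x / T) := by
  have hpos : (0 : ℝ) < T := by exact_mod_cast hT
  rw [ENNReal.ofReal_div_of_pos hpos, ENNReal.ofReal_natCast, ENNReal.div_eq_inv_mul]

lemma ofReal_le_liminf_average {u : ℕ → ENNReal} {L C : ℝ}
    (h : ∀ T : ℕ, 1 ≤ T → ENNReal.ofReal (T * L - C) ≤ u T) :
    ENNReal.ofReal L ≤ liminf (fun T : ℕ => (T : ENNReal)⁻¹ * u T) atTop := by
  have ht : Tendsto (fun T : ℕ => ENNReal.ofReal (L - C / T)) atTop (nhds (ENNReal.ofReal L)) := by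
    refine (ENNReal.continuous_ofReal.tendsto L).comp ?_
    simpa using tendsto_const_nhds.sub (tendsto_const_div_atTop_nhds_zero_nat C)
  rw [← ht.liminf_eq]
  refine liminf_le_liminf ?_
  filter_upwards [eventually_ge_atTop 1] with T hT
  refine le_trans (le_of_eq ?_) (mul_le_mul_right (h T hT) _)
  have hpos : (0 : ℝ) < T := by exact_mod_cast hT
  rw [ENNReal.inv_natCast_mul_ofReal hT]
  congr 1
  field_simp

lemma limsup_average_le_ofReal {u : ℕ → ENNReal} {U C : ℝ}
    (h : ∀ᶠ T : ℕ in atTop, u T ≤ ENNReal.ofReal (T * U + C)) :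
    limsup (fun T : ℕ => (T : ENNReal)⁻¹ * u T) atTop ≤ ENNReal.ofReal U := by
  have ht : Tendsto (fun T : ℕ => ENNReal.ofReal (U + C / T)) atTop (nhds (ENNReal.ofReal U)) := by
    refine (ENNReal.continuous_ofReal.tendsto U).comp ?_
    simpa using tendsto_const_nhds.add (tendsto_const_div_atTop_nhds_zero_nat C)
  rw [← ht.limsup_eq]
  refine limsup_le_limsup ?_
  filter_upwards [eventually_ge_atTop 1, h] with T hT hu
  refine (mul_le_mul_right hu _).trans (le_of_eq ?_)
  have hpos : (0 : ℝ) < T := by exact_mod_cast hT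
  rw [ENNReal.inv_natCast_mul_ofReal hT]
  congr 1
  field_simp

/-- Removing a constant from each summand, with a shift by one time step. -/
lemma limsup_average_le_of_add_le {u v : ℕ → ENNReal} {B q : ℝ} (hB : 0 ≤ B) (hq : 0 ≤ q)
    (huv : ∀ T : ℕ, u T + ENNReal.ofReal (T * q) ≤ v (T + 1))
    (hv : limsup (fun T : ℕ => (T : ENNReal)⁻¹ * v T) atTop ≤ ENNReal.ofReal (B + q)) :
    limsup (fun T : ℕ => (T : ENNReal)⁻¹ * u T) atTop ≤ ENNReal.ofReal B := by
  refine ENNReal.le_of_forall_pos_le_add fun ε hε _ => ?_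
  have hε' : (0 : ℝ) < ε := hε
  rw [← ENNReal.ofReal_coe_nnreal, ← ENNReal.ofReal_add hB hε'.le]
  have hlt : limsup (fun T : ℕ => (T : ENNReal)⁻¹ * v T) atTop < ENNReal.ofReal (B + q + ε) :=
    hv.trans_lt ((ENNReal.ofReal_lt_ofReal_iff (by linarith)).2 (by linarith))
  have hev := (tendsto_add_atTop_nat 1).eventually (eventually_lt_of_limsup_lt hlt)
  -- The constant is the contribution of the one extra time step in `v (T + 1)`.
  refine limsup_average_le_ofReal (C := B + q + ε) ?_
  filter_upwards [hev] with T hT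
  have hT0 : ((T + 1 : ℕ) : ENNReal) ≠ 0 := by simp
  have hv1 : v (T + 1) ≤ ENNReal.ofReal ((T + 1) * (B + q + ε)) := by
    have h1 := mul_le_mul_right hT.le ((T + 1 : ℕ) : ENNReal)
    rw [← mul_assoc, ENNReal.mul_inv_cancel hT0 (ENNReal.natCast_ne_top _), one_mul] at h1
    refine h1.trans (le_of_eq ?_)
    rw [ENNReal.ofReal_mul (by positivity), ← ENNReal.ofReal_natCast]
    push_cast
    rfl
  have h2 : u T + ENNReal.ofReal (T * q) ≤
      ENNReal.ofReal (T * (B + ε) + (B + q + ε)) + ENNReal.ofReal (T * q) := by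
    rw [← ENNReal.ofReal_add (by positivity) (by positivity)]
    refine ((huv T).trans hv1).trans (le_of_eq ?_)
    congr 1
    ring
  exact (ENNReal.add_le_add_iff_right ENNReal.ofReal_ne_top).1 h2

/-! ### The order of magnitude of the bounds -/

/-- Subtracting the diagonal of the expanded square leaves `M (M - 1)` nonnegative terms, which can
be compared one by one. -/
lemma sq_sum_sqrt_sub_sum {M : ℕ} {x : Fin M → ℝ} (hx : ∀ i, 0 ≤ x i) :
    (∑ i, √(x i)) ^ 2 - ∑ i, x i = ∑ i, ∑ j, if i = j then 0 else √(x i) * √(x j) := by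
  rw [sq, Finset.sum_mul_sum, ← Finset.sum_sub_distrib]
  refine Finset.sum_congr rfl fun i _ => ?_
  have : x i = ∑ j, if i = j then √(x i) * √(x j) else 0 := by simp [Real.mul_self_sqrt (hx i)]
  rw [this, ← Finset.sum_sub_distrib]
  refine Finset.sum_congr rfl fun j _ => ?_
  rw [← this]
  split_ifs <;> simp

lemma sum_sum_off_diag_const (M : ℕ) (a : ℝ) :
    ∑ i : Fin M, ∑ j, (if i = j then 0 else a) = a * (M * (M - 1)) := by
  have : ∀ i : Fin M, ∑ j, (if i = j then 0 else a) = M * a - a := by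
    intro i
    have h : ∀ j, (if i = j then 0 else a) = a - if i = j then a else 0 := by
      intro j; split_ifs <;> simp
    simp [h]
  simp only [this, Finset.sum_const, Finset.card_univ, Fintype.card_fin, nsmul_eq_mul]
  ring

lemma mul_le_sq_sum_sqrt_sub_sum {M : ℕ} {x : Fin M → ℝ} {a : ℝ} (ha : 0 ≤ a)
    (hx : ∀ i, a ≤ x i) : a * (M * (M - 1)) ≤ (∑ i, √(x i)) ^ 2 - ∑ i, x i := by
  rw [sq_sum_sqrt_sub_sum fun i => ha.trans (hx i), ← sum_sum_off_diag_const]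
  refine Finset.sum_le_sum fun i _ => Finset.sum_le_sum fun j _ => ?_
  split_ifs
  · exact le_rfl
  · calc a = √a * √a := (Real.mul_self_sqrt ha).symm
      _ ≤ √(x i) * √(x j) := mul_le_mul (Real.sqrt_le_sqrt (hx i)) (Real.sqrt_le_sqrt (hx j))
        (Real.sqrt_nonneg _) (Real.sqrt_nonneg _)

lemma sq_sum_sqrt_sub_sum_le_mul {M : ℕ} {x : Fin M → ℝ} {b : ℝ} (hx : ∀ i, 0 ≤ x i)
    (hb : ∀ i, x i ≤ b) : (∑ i, √(x i)) ^ 2 - ∑ i, x i ≤ b * (M * (M - 1)) := by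
  rw [sq_sum_sqrt_sub_sum hx, ← sum_sum_off_diag_const]
  refine Finset.sum_le_sum fun i _ => Finset.sum_le_sum fun j _ => ?_
  split_ifs
  · exact le_rfl
  · calc √(x i) * √(x j) ≤ √b * √b := mul_le_mul (Real.sqrt_le_sqrt (hb i))
          (Real.sqrt_le_sqrt (hb j)) (Real.sqrt_nonneg _) (Real.sqrt_nonneg _)
      _ = b := Real.mul_self_sqrt ((hx i).trans (hb i))

/-! ### Bounds for policies -/

/-- The expected posterior error variance at time `t` along the schedule of a policy. -/
noncomputable def expectedPostVar {M : ℕ} {Ω S : Type*} [MeasurableSpace Ω] [MeasurableSpace S]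
    (μ : Measure Ω) (Q P₀ : Matrix (Fin M) (Fin M) ℝ)
    (x₀ : Ω → EuclideanSpace ℝ (Fin M)) (w : ℕ → Ω → EuclideanSpace ℝ (Fin M))
    (ξ : Ω → S) (π : ObliviousPolicy M S) (t : ℕ) : ENNReal :=
  ∫⁻ ω, ENNReal.ofReal (postCov
    (kalmanCov Q P₀ (π.sensor (ξ ω) (fun k => stateAt x₀ w k ω)) t)
    (π.sensor (ξ ω) (fun k => stateAt x₀ w k ω) t)).trace ∂μ

/-- The policy that follows a fixed schedule. -/
def ObliviousPolicy.ofSchedule {M : ℕ} (S : Type*) [MeasurableSpace S] (c : ℕ → Fin M) :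
    ObliviousPolicy M S where
  decide t _ := c t
  measurable_decide _ := measurable_const

lemma sum_range_le_add_sum_Icc {f : ℕ → ℝ} (hf : ∀ t, 0 ≤ f t) (T : ℕ) :
    ∑ t ∈ Finset.range T, f t ≤ f 0 + ∑ t ∈ Finset.Icc 1 T, f t := by
  rw [← Finset.sum_insert (by simp)]
  refine Finset.sum_le_sum_of_subset_of_nonneg (fun t ht => ?_) fun t _ _ => hf t
  have := Finset.mem_range.1 ht
  rw [Finset.mem_insert, Finset.mem_Icc]
  omega

section Bounds

variable {M : ℕ} {Ω S : Type*} [MeasurableSpace Ω] [MeasurableSpace S] {μ : Measure Ω}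
  [IsProbabilityMeasure μ] {Q P₀ : Matrix (Fin M) (Fin M) ℝ} {xhat₀ : EuclideanSpace ℝ (Fin M)}
  {x₀ : Ω → EuclideanSpace ℝ (Fin M)} {w : ℕ → Ω → EuclideanSpace ℝ (Fin M)} {ξ : Ω → S}

omit [IsProbabilityMeasure μ] in
lemma IsSourceModel.measurable_ofReal_postVar (h : IsSourceModel μ Q P₀ xhat₀ x₀ w ξ)
    (i₀ : Fin M) (π : ObliviousPolicy M S) (t : ℕ) :
    Measurable fun ω => ENNReal.ofReal (postCov
      (kalmanCov Q P₀ (π.sensor (ξ ω) (fun k => stateAt x₀ w k ω)) t)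
      (π.sensor (ξ ω) (fun k => stateAt x₀ w k ω) t)).trace :=
  π.measurable_comp_sensor h.measurable_seed h.measurable_stateAt i₀
    (fun c => ENNReal.ofReal (postCov (kalmanCov Q P₀ c t) (c t)).trace) (t + 1)
    fun c d hcd => by
      rw [kalmanCov_congr Q P₀ fun k hk => hcd k (by omega), hcd t (by omega)]

omit [IsProbabilityMeasure μ] in
lemma IsSourceModel.averageError_eq (h : IsSourceModel μ Q P₀ xhat₀ x₀ w ξ)
    (π : ObliviousPolicy M S) (η : EstimationPolicy M) (T : ℕ) :
    averageError μ x₀ w ξ π η T = (T : ENNReal)⁻¹ * ∑ t ∈ Finset.Icc 1 T,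
      ∫⁻ ω, ‖stateAt x₀ w t ω -
        η.estimate t (π.history (ξ ω) (fun k => stateAt x₀ w k ω) (t + 1))‖ₑ ^ 2 ∂μ := by
  rw [averageError, lintegral_finsetSum]
  intro t _
  have h1 : Measurable fun ω => π.history (ξ ω) (fun k => stateAt x₀ w k ω) (t + 1) := by
    simp only [π.history_eq]
    exact measurable_pi_iff.2 fun k =>
      (π.measurable_sensor h.measurable_seed h.measurable_stateAt k).prodMk
        (measurable_eval_index (h.measurable_stateAt k)
          (π.measurable_sensor h.measurable_seed h.measurable_stateAt k))
  exact (((h.measurable_stateAt t).sub ((η.measurable_estimate t).comp h1)).enorm).pow_const 2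

lemma IsSourceModel.expectedPostVar_le (h : IsSourceModel μ Q P₀ xhat₀ x₀ w ξ)
    (hQ : Q.PosSemidef) (hP₀ : P₀.PosSemidef) (i₀ : Fin M) (π : ObliviousPolicy M S)
    (η : EstimationPolicy M) (t : ℕ) :
    expectedPostVar μ Q P₀ x₀ w ξ π t ≤ ∫⁻ ω, ‖stateAt x₀ w t ω -
        η.estimate t (π.history (ξ ω) (fun k => stateAt x₀ w k ω) (t + 1))‖ₑ ^ 2 ∂μ := by
  rw [h.lintegral_error_eq hQ hP₀ i₀ π t (η.measurable_estimate t)]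
  exact lintegral_mono fun ω => le_self_add

/-- The Kalman estimator. -/
noncomputable def kalmanEstimator (Q P₀ : Matrix (Fin M) (Fin M) ℝ)
    (xhat₀ : EuclideanSpace ℝ (Fin M)) (i₀ : Fin M) : EstimationPolicy M where
  estimate _ h := h.kalmanEstimate Q P₀ xhat₀ i₀
  measurable_estimate t := History.measurable_kalmanEstimate Q P₀ xhat₀ i₀ (t + 1)

lemma IsSourceModel.monitoringError_le (h : IsSourceModel μ Q P₀ xhat₀ x₀ w ξ)
    (hQ : Q.PosSemidef) (hP₀ : P₀.PosSemidef) (i₀ : Fin M) (π : ObliviousPolicy M S) :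
    monitoringError μ x₀ w ξ π ≤ limsup (fun T : ℕ => (T : ENNReal)⁻¹ *
      ∑ t ∈ Finset.Icc 1 T, expectedPostVar μ Q P₀ x₀ w ξ π t) atTop := by
  refine (iInf_le _ (kalmanEstimator Q P₀ xhat₀ i₀)).trans (le_of_eq ?_)
  congr 1
  funext T
  rw [h.averageError_eq]
  congr 1
  refine Finset.sum_congr rfl fun t _ => ?_
  rw [h.lintegral_error_eq hQ hP₀ i₀ π t ((kalmanEstimator Q P₀ xhat₀ i₀).measurable_estimate t)]
  simp [kalmanEstimator, expectedPostVar]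

lemma lintegral_kalmanCov_succ (hQ : Q.PosSemidef) (hP₀ : P₀.PosSemidef)
    (π : ObliviousPolicy M S) (t : ℕ) :
    ∫⁻ ω, ENNReal.ofReal (kalmanCov Q P₀ (π.sensor (ξ ω) (fun k => stateAt x₀ w k ω))
        (t + 1)).trace ∂μ =
      expectedPostVar μ Q P₀ x₀ w ξ π t + ENNReal.ofReal Q.trace := by
  simp only [kalmanCov_succ, trace_add]
  rw [expectedPostVar]
  simp_rw [fun ω => ENNReal.ofReal_add (posSemidef_postCov (posSemidef_kalmanCov hQ hP₀
    (π.sensor (ξ ω) (fun k => stateAt x₀ w k ω)) t)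
    (π.sensor (ξ ω) (fun k => stateAt x₀ w k ω) t)).trace_nonneg hQ.trace_nonneg]
  rw [lintegral_add_right _ measurable_const]
  simp

/-- The window of posterior variances is `0, …, T - 1`, one step behind the window `1, …, T` of the
monitoring error; later comparisons account for this shift. -/
lemma sum_kalmanCov_eq (hQ : Q.PosSemidef) (hP₀ : P₀.PosSemidef)
    (π : ObliviousPolicy M S) (T : ℕ) :
    ∑ t ∈ Finset.Icc 1 T, ∫⁻ ω, ENNReal.ofReal
      (kalmanCov Q P₀ (π.sensor (ξ ω) (fun k => stateAt x₀ w k ω)) t).trace ∂μ =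
      ∑ t ∈ Finset.range T, expectedPostVar μ Q P₀ x₀ w ξ π t + ENNReal.ofReal (T * Q.trace) := by
  induction T with
  | zero => simp
  | succ T ih =>
    rw [Finset.sum_Icc_succ_top (by omega), ih, lintegral_kalmanCov_succ hQ hP₀,
      Finset.sum_range_succ]
    have hq := hQ.trace_nonneg
    have : ENNReal.ofReal ((T + 1 : ℕ) * Q.trace) =
        ENNReal.ofReal (T * Q.trace) + ENNReal.ofReal Q.trace := by
      rw [← ENNReal.ofReal_add (by positivity) hq]
      push_cast
      ring_nf
    rw [this]
    ac_rfl

lemma sum_postVar_lower_bound {c : ℕ → Fin M} (hQ : Q.PosDef) (hP₀ : P₀.PosSemidef) (T : ℕ) :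
    T * (1 / 2 * (∑ i, √(qTilde Q i)) ^ 2 - 1 / 2 * ∑ i, qTilde Q i) -
        ∑ i, 1 / 2 * (√(qTilde Q i) - ∑ j, √(qTilde Q j)) ^ 2 ≤
      ∑ t ∈ Finset.Icc 1 T, (postCov (kalmanCov Q P₀ c t) (c t)).trace :=
  (sum_age_lower_bound _ (qTilde_nonneg hQ) c T).trans
    (Finset.sum_le_sum fun t _ => sum_qTilde_mul_sampleAge_le_trace hQ hP₀ c t)

/-- The deterministic bound is uniform over schedules, so it holds for the realized schedule at
every `ω` and survives integration. -/
lemma IsSourceModel.le_sum_expectedPostVar (h : IsSourceModel μ Q P₀ xhat₀ x₀ w ξ)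
    (hQ : Q.PosDef) (hP₀ : P₀.PosSemidef) (i₀ : Fin M) (π : ObliviousPolicy M S) (T : ℕ) :
    ENNReal.ofReal (T * (1 / 2 * (∑ i, √(qTilde Q i)) ^ 2 - 1 / 2 * ∑ i, qTilde Q i) -
        ∑ i, 1 / 2 * (√(qTilde Q i) - ∑ j, √(qTilde Q j)) ^ 2) ≤
      ∑ t ∈ Finset.Icc 1 T, expectedPostVar μ Q P₀ x₀ w ξ π t := by
  simp only [expectedPostVar]
  rw [← lintegral_finsetSum _ fun t _ => h.measurable_ofReal_postVar i₀ π t]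
  have hconst := lintegral_mono (μ := μ) fun ω =>
    (ENNReal.ofReal_le_ofReal (sum_postVar_lower_bound
      (c := π.sensor (ξ ω) (fun k => stateAt x₀ w k ω)) hQ hP₀ T))
  rw [lintegral_const, measure_univ, mul_one] at hconst
  refine hconst.trans (le_of_eq (lintegral_congr fun ω => ?_))
  exact ENNReal.ofReal_sum_of_nonneg fun t _ => (posSemidef_postCov
    (posSemidef_kalmanCov hQ.posSemidef hP₀ _ t) _).trace_nonneg

lemma expectedPostVar_ofSchedule (c : ℕ → Fin M) (t : ℕ) :
    expectedPostVar μ Q P₀ x₀ w ξ (ObliviousPolicy.ofSchedule S c) t =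
      ENNReal.ofReal (postCov (kalmanCov Q P₀ c t) (c t)).trace := by
  change ∫⁻ _, ENNReal.ofReal (postCov (kalmanCov Q P₀ c t) (c t)).trace ∂μ = _
  simp

lemma IsSourceModel.le_liminf_averageError (h : IsSourceModel μ Q P₀ xhat₀ x₀ w ξ)
    (hQ : Q.PosDef) (hP₀ : P₀.PosSemidef) (i₀ : Fin M) (π : ObliviousPolicy M S)
    (η : EstimationPolicy M) :
    ENNReal.ofReal (1 / 2 * (∑ i, √(qTilde Q i)) ^ 2 - 1 / 2 * ∑ i, qTilde Q i)
      ≤ liminf (averageError μ x₀ w ξ π η) atTop := by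
  simp only [funext (h.averageError_eq π η)]
  exact ofReal_le_liminf_average fun T _ => (h.le_sum_expectedPostVar hQ hP₀ i₀ π T).trans
    (Finset.sum_le_sum fun t _ => h.expectedPostVar_le hQ.posSemidef hP₀ i₀ π η t)

lemma IsSourceModel.le_monitoringError (h : IsSourceModel μ Q P₀ xhat₀ x₀ w ξ)
    (hQ : Q.PosDef) (hP₀ : P₀.PosSemidef) (i₀ : Fin M) (π : ObliviousPolicy M S) :
    ENNReal.ofReal (1 / 2 * (∑ i, √(qTilde Q i)) ^ 2 - 1 / 2 * ∑ i, qTilde Q i)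
      ≤ monitoringError μ x₀ w ξ π :=
  le_iInf fun η => (h.le_liminf_averageError hQ hP₀ i₀ π η).trans liminf_le_limsup

lemma IsSourceModel.le_kalmanCost (h : IsSourceModel μ Q P₀ xhat₀ x₀ w ξ)
    (hQ : Q.PosDef) (hP₀ : P₀.PosSemidef) (i₀ : Fin M) (π : ObliviousPolicy M S) :
    ENNReal.ofReal (1 / 2 * (∑ i, √(qTilde Q i)) ^ 2 - 1 / 2 * ∑ i, qTilde Q i + Q.trace)
      ≤ kalmanCost μ Q P₀ x₀ w ξ π := by
  set L := 1 / 2 * (∑ i, √(qTilde Q i)) ^ 2 - 1 / 2 * ∑ i, qTilde Q i with hL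
  set C := ∑ i, 1 / 2 * (√(qTilde Q i) - ∑ j, √(qTilde Q j)) ^ 2 with hC
  -- The additional `L` pays for the posterior term at time 0, which the lower bound does not use.
  refine le_trans (ofReal_le_liminf_average (C := C + L) fun T hT => ?_) liminf_le_limsup
  rw [sum_kalmanCov_eq hQ.posSemidef hP₀]
  obtain ⟨T, rfl⟩ : ∃ n, T = n + 1 := ⟨T - 1, by omega⟩
  have h1 : ENNReal.ofReal (T * L - C) ≤
      ∑ t ∈ Finset.range (T + 1), expectedPostVar μ Q P₀ x₀ w ξ π t := by
    refine (h.le_sum_expectedPostVar hQ hP₀ i₀ π T).trans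
      (Finset.sum_le_sum_of_subset fun t ht => ?_)
    rw [Finset.mem_range]
    have := Finset.mem_Icc.1 ht
    omega
  refine le_trans (le_of_eq_of_le ?_ ENNReal.ofReal_add_le) (add_le_add h1 le_rfl)
  congr 1
  push_cast
  ring

/-- The greedy schedule serves both objectives. For the Kalman cost, the posterior trace at time 0
enters the bounded correction. -/
lemma IsSourceModel.exists_policy_le (h : IsSourceModel μ Q P₀ xhat₀ x₀ w ξ)
    (hM : 0 < M) (hQ : Q.PosDef) (hP₀ : P₀.PosSemidef) :
    ∃ π : ObliviousPolicy M S,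
      monitoringError μ x₀ w ξ π ≤ ENNReal.ofReal ((∑ i, √(Q i i)) ^ 2 - ∑ i, Q i i) ∧
      kalmanCost μ Q P₀ x₀ w ξ π ≤
        ENNReal.ofReal ((∑ i, √(Q i i)) ^ 2 - ∑ i, Q i i + Q.trace) := by
  obtain ⟨c, C, hc⟩ := exists_schedule_trace_le hM hQ hP₀
  have hnn : ∀ t, 0 ≤ (postCov (kalmanCov Q P₀ c t) (c t)).trace := fun t =>
    (posSemidef_postCov (posSemidef_kalmanCov hQ.posSemidef hP₀ _ t) _).trace_nonneg
  refine ⟨ObliviousPolicy.ofSchedule S c,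
    (h.monitoringError_le hQ.posSemidef hP₀ ⟨0, hM⟩ _).trans
      (limsup_average_le_ofReal (C := C) (Eventually.of_forall fun T => ?_)),
    limsup_average_le_ofReal
      (C := (postCov (kalmanCov Q P₀ c 0) (c 0)).trace + C) (Eventually.of_forall fun T => ?_)⟩
  · simp only [expectedPostVar_ofSchedule]
    rw [← ENNReal.ofReal_sum_of_nonneg fun t _ => hnn t]
    exact ENNReal.ofReal_le_ofReal (hc T)
  · rw [sum_kalmanCov_eq hQ.posSemidef hP₀]
    simp only [expectedPostVar_ofSchedule]
    rw [← ENNReal.ofReal_sum_of_nonneg fun t _ => hnn t, ← ENNReal.ofReal_add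
      (Finset.sum_nonneg fun t _ => hnn t) (mul_nonneg (by positivity) hQ.posSemidef.trace_nonneg)]
    refine ENNReal.ofReal_le_ofReal ?_
    have h1 := sum_range_le_add_sum_Icc hnn T
    have h2 := hc T
    linarith

/-- The monitoring error is controlled by the Kalman cost. -/
lemma IsSourceModel.monitoringError_le_of_kalmanCost_le (h : IsSourceModel μ Q P₀ xhat₀ x₀ w ξ)
    (hQ : Q.PosSemidef) (hP₀ : P₀.PosSemidef) (i₀ : Fin M) (π : ObliviousPolicy M S) {B : ℝ}
    (hB : 0 ≤ B) (hcost : kalmanCost μ Q P₀ x₀ w ξ π ≤ ENNReal.ofReal (B + Q.trace)) :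
    monitoringError μ x₀ w ξ π ≤ ENNReal.ofReal B := by
  refine (h.monitoringError_le hQ hP₀ i₀ π).trans
    (limsup_average_le_of_add_le hB hQ.trace_nonneg (fun T => ?_) hcost)
  rw [sum_kalmanCov_eq hQ hP₀]
  refine add_le_add (Finset.sum_le_sum_of_subset fun t ht => ?_) (ENNReal.ofReal_le_ofReal ?_)
  · rw [Finset.mem_range]
    have := Finset.mem_Icc.1 ht
    omega
  · exact mul_le_mul_of_nonneg_right (by push_cast; linarith) hQ.trace_nonneg

end Bounds

theorem theorem3 {M : ℕ} (hM : 0 < M) {Ω S : Type*} [MeasurableSpace Ω] [MeasurableSpace S]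
    (μ : Measure Ω) [IsProbabilityMeasure μ]
    (Q P₀ : Matrix (Fin M) (Fin M) ℝ) (hQ : Q.PosSemidef) (hQinv : IsUnit Q)
    (hP₀ : P₀.PosSemidef) (xhat₀ : EuclideanSpace ℝ (Fin M))
    (x₀ : Ω → EuclideanSpace ℝ (Fin M)) (w : ℕ → Ω → EuclideanSpace ℝ (Fin M)) (ξ : Ω → S)
    (hmodel : IsSourceModel μ Q P₀ xhat₀ x₀ w ξ) :
    -- the bounds for the optimal error
    (ENNReal.ofReal (1 / 2 * (∑ i, √(qTilde Q i)) ^ 2 - 1 / 2 * ∑ i, qTilde Q i)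
        ≤ optimalError μ x₀ w ξ ∧
      optimalError μ x₀ w ξ ≤ ENNReal.ofReal ((∑ i, √(Q i i)) ^ 2 - ∑ i, Q i i)) ∧
    -- the lower bound holds for every policy and estimator, also for the limit inferior
    (∀ (π : ObliviousPolicy M S) (η : EstimationPolicy M),
      ENNReal.ofReal (1 / 2 * (∑ i, √(qTilde Q i)) ^ 2 - 1 / 2 * ∑ i, qTilde Q i)
        ≤ liminf (averageError μ x₀ w ξ π η) atTop) ∧
    -- the bounds for the monitoring error of a policy that is optimal for the Kalman recursion
    (∀ π : ObliviousPolicy M S, IsKalmanOptimal μ Q P₀ x₀ w ξ π →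
      ENNReal.ofReal (1 / 2 * (∑ i, √(qTilde Q i)) ^ 2 - 1 / 2 * ∑ i, qTilde Q i)
        ≤ monitoringError μ x₀ w ξ π ∧
      monitoringError μ x₀ w ξ π ≤ ENNReal.ofReal ((∑ i, √(Q i i)) ^ 2 - ∑ i, Q i i)) ∧
    -- the bounds for the optimal value of the Kalman problem, which exceeds the error by `tr Q`
    (ENNReal.ofReal (1 / 2 * (∑ i, √(qTilde Q i)) ^ 2 - 1 / 2 * ∑ i, qTilde Q i + Q.trace)
        ≤ (⨅ π : ObliviousPolicy M S, kalmanCost μ Q P₀ x₀ w ξ π) ∧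
      (⨅ π : ObliviousPolicy M S, kalmanCost μ Q P₀ x₀ w ξ π)
        ≤ ENNReal.ofReal ((∑ i, √(Q i i)) ^ 2 - ∑ i, Q i i + Q.trace)) ∧
    -- the order of magnitude `M²`
    (∀ a b : ℝ, (∀ i, a ≤ qTilde Q i) → (∀ i, Q i i ≤ b) →
      ENNReal.ofReal (a / 2 * (M * (M - 1))) ≤ optimalError μ x₀ w ξ ∧
      optimalError μ x₀ w ξ ≤ ENNReal.ofReal (b * (M * (M - 1)))) := by
  have hQpos : Q.PosDef := hQ.posDef_iff_isUnit.2 hQinv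
  have hlow : ENNReal.ofReal (1 / 2 * (∑ i, √(qTilde Q i)) ^ 2 - 1 / 2 * ∑ i, qTilde Q i)
      ≤ optimalError μ x₀ w ξ := le_iInf fun π =>
    hmodel.le_monitoringError hQpos hP₀ ⟨0, hM⟩ π
  obtain ⟨π₀, herr, hcost⟩ := hmodel.exists_policy_le hM hQpos hP₀
  have hup : optimalError μ x₀ w ξ ≤ ENNReal.ofReal ((∑ i, √(Q i i)) ^ 2 - ∑ i, Q i i) :=
    (iInf_le _ π₀).trans herr
  -- The case `a = 0` of the off-diagonal comparison. Nonnegativity is needed to recover the bound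
  -- from its `ENNReal.ofReal` form after `tr Q` is removed.
  have hUB : 0 ≤ (∑ i, √(Q i i)) ^ 2 - ∑ i, Q i i := by
    simpa using mul_le_sq_sum_sqrt_sub_sum le_rfl fun i => hQ.diag_nonneg (i := i)
  refine ⟨⟨hlow, hup⟩, hmodel.le_liminf_averageError hQpos hP₀ ⟨0, hM⟩, fun π hπ =>
    ⟨hmodel.le_monitoringError hQpos hP₀ ⟨0, hM⟩ π,
      hmodel.monitoringError_le_of_kalmanCost_le hQ hP₀ ⟨0, hM⟩ π hUB ((hπ π₀).trans hcost)⟩,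
    ⟨le_iInf fun π => hmodel.le_kalmanCost hQpos hP₀ ⟨0, hM⟩ π, (iInf_le _ π₀).trans hcost⟩,
    fun a b ha hb => ⟨?_, hup.trans (ENNReal.ofReal_le_ofReal
      (sq_sum_sqrt_sub_sum_le_mul (fun i => hQ.diag_nonneg) hb))⟩⟩
  rcases le_or_gt 0 a with h0 | h0
  · refine le_trans (ENNReal.ofReal_le_ofReal ?_) hlow
    have := mul_le_sq_sum_sqrt_sub_sum h0 ha
    linarith
  -- For negative `a` the left bound is nonpositive, so its `ENNReal.ofReal` is zero.
  · have hM1 : (1 : ℝ) ≤ M := by exact_mod_cast hM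
    rw [ENNReal.ofReal_of_nonpos]
    · exact zero_le
    · exact mul_nonpos_of_nonpos_of_nonneg (by linarith)
        (mul_nonneg (by linarith) (by linarith))
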